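/- Let $p$ be a prime, $k$ a field of characteristic $p$, $G$ a finite group and $H\le G$ a subgroup whose index is prime to $p$. Definitions. For a finite group $G$ let $kG\text{-stab}$ be the stable category of finitely generated $kG$-modules (the quotient of $kG\text{-mod}$ that identifies two maps when their difference factors through a projective module), with $\otimes=\otimes_k$. Let $T(G)$ be the group of isomorphism classes of $\otimes$-invertible objects of $kG\text{-stab}$ (the group of endotrivial modules), and $T(G,H)=\ker(\mathrm{Res}:T(G)\to T(H))$. For a finite $G$-set $X$ let $\mathrm{Rep}(X)$ be the category of functors from the action groupoid $G\ltimes X$ (objects $x\in X$, arrows $x\to gx$) to $k$-vector spaces, and let $\mathrm{StRep}(X)$ be its quotient by the maps that factor through a projective object. A $G$-map $\alpha:Y\to X$ gives $\alpha^*:\mathrm{StRep}(X)\to\mathrm{StRep}(Y)$. Let $\mathbb 1\in\mathrm{StRep}(X)$ be the constant representation $k$, and let $\mathbb G_m(X)=\mathrm{Aut}_{\mathrm{StRep}(X)}(\mathbb 1)$, a presheaf of abelian groups on finite $G$-sets. For an abelian group $A$, the constant sipp sheaf $\underline A$ is $\underline A(X)=A^{\overline X}$, where $\overline X$ is the set of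 $G$-orbits $Gx$ of $X$ with $p$ dividing $|\mathrm{St}_G(x)|$. A map $\alpha:U\to X$ of finite $G$-sets is a sipp-cover if every $x\in X$ has a preimage $u\in U$ with $[\mathrm{St}_G(x):\mathrm{St}_G(u)]$ prime to $p$. For $\mathcal U=\{U\to X\}$ and a presheaf $P$ of abelian groups, $\check H^n(\mathcal U,P)$ is the $n$-th cohomology of the Čech complex with $P(U^{(n+1)})$ in degree $n$, where $U^{(n)}=U\times_X\cdots\times_XU$ ($n$ factors), and with the alternating sum of the maps induced by the projections that omit one factor as differential. Theorem. The map $G/H\to G/G$ is a sipp-cover; put $\mathcal U=\{G/H\to G/G\}$. (i) $\mathbb G_m$ is the constant sipp sheaf $\underline{k^\times}$: there is an isomorphism of presheaves $\underline{k^\times}\cong\mathbb G_m$ that sends $c:\overline X\to k^\times$ to the stable class of any automorphism of the constant representation $k$ on $X$ that acts at $x$ as multiplication by $c(Gx)$ for all $x$ with $p\mid|\mathrm{St}_G(x)|$. (ii) There is a canonical isomorphism of groups $\Phi:T(G,H)\cong\check H^1(\mathcal U,\mathbb G_m)$. Explicitly, write $V$ also for the representation of a $G$-set with value $V$ at every point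 that a $kG$-module $V$ defines. If the class of $V$ lies in $T(G,H)$, then there are isomorphisms $f:V\to\mathbb 1$ in $\mathrm{StRep}(G/H)$; for each of them, $\mathrm{pr}_1^*(f)\circ\mathrm{pr}_2^*(f)^{-1}\in\mathbb G_m((G/H)^{(2)})$ is a Čech $1$-cocycle, and its class is $\Phi([V])$. The group isomorphism $\Phi$ is uniquely determined by this property. -/

import Mathlib

open CategoryTheory Limits MonoidalCategory Opposite

universe u v w

namespace SippCech

section Trace

set_option linter.unusedSectionVars false

/-- The identity of `P` is a trace of a family of (not necessarily equivariant) endomorphisms.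
For representations of finite groupoids over a field, this characterizes projectivity. -/
def IsTraceSplit {J A : Type*} [Category* J] [IsGroupoid J] [Category* A] [Preadditive A]
    [∀ x : J, Finite (Σ y : J, y ⟶ x)] (P : J ⥤ A) : Prop :=
  ∃ θ : ∀ x, P.obj x ⟶ P.obj x, ∀ x,
    letI := Fintype.ofFinite (Σ y : J, y ⟶ x)
    ∑ a : (Σ y : J, y ⟶ x), P.map (inv a.2) ≫ θ a.1 ≫ P.map a.2 = 𝟙 (P.obj x)

variable {J J' A : Type*} [Category* J] [IsGroupoid J] [Category* J'] [IsGroupoid J']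
  [Category* A] [Preadditive A]
  [∀ x : J, Finite (Σ y : J, y ⟶ x)] [∀ x : J', Finite (Σ y : J', y ⟶ x)]

/-- The direct sum of all `P y` over all arrows `y ⟶ x`. -/
noncomputable abbrev freeObj [HasFiniteBiproducts A] (P : J ⥤ A) (x : J) : A :=
  ⨁ fun a : (Σ y : J, y ⟶ x) => P.obj a.1

/-- The inclusion of the summand of `freeObj P x` indexed by an arrow. -/
noncomputable def freeι [HasFiniteBiproducts A] (P : J ⥤ A) {y x : J} (f : y ⟶ x) :
    P.obj y ⟶ freeObj P x :=
  biproduct.ι (fun a : (Σ y : J, y ⟶ x) => P.obj a.1) ⟨y, f⟩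

/-- Functoriality of `freeObj`: an arrow `h` permutes the summands by composition with `h`. -/
noncomputable def freeMap [HasFiniteBiproducts A] (P : J ⥤ A) {x x' : J} (h : x ⟶ x') :
    freeObj P x ⟶ freeObj P x' :=
  biproduct.desc fun a => freeι P (a.2 ≫ h)

theorem freeι_map [HasFiniteBiproducts A] (P : J ⥤ A) {y x x' : J} (f : y ⟶ x) (h : x ⟶ x') :
    freeι P f ≫ freeMap P h = freeι P (f ≫ h) :=
  biproduct.ι_desc _ _

theorem freeObj_hom_ext [HasFiniteBiproducts A] (P : J ⥤ A) {x : J} {B : A}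
    {u v : freeObj P x ⟶ B} (h : ∀ (y : J) (f : y ⟶ x), freeι P f ≫ u = freeι P f ≫ v) : u = v :=
  biproduct.hom_ext' _ _ fun a => h a.1 a.2

/-- The free representation on the underlying family of objects of `P`. -/
noncomputable def freeCover [HasFiniteBiproducts A] (P : J ⥤ A) : J ⥤ A where
  obj x := freeObj P x
  map h := freeMap P h
  map_id x := freeObj_hom_ext P fun y f => by
    rw [freeι_map, Category.comp_id, Category.comp_id]
  map_comp f g := freeObj_hom_ext P fun y h => by
    rw [← Category.assoc, freeι_map, freeι_map, freeι_map, Category.assoc]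

/-- The map `freeObj P x ⟶ P x` given by the action of arrows. -/
noncomputable def freeDesc [HasFiniteBiproducts A] (P : J ⥤ A) (x : J) :
    freeObj P x ⟶ P.obj x :=
  biproduct.desc fun a => P.map a.2

theorem freeι_desc [HasFiniteBiproducts A] (P : J ⥤ A) {y x : J} (f : y ⟶ x) :
    freeι P f ≫ freeDesc P x = P.map f :=
  biproduct.ι_desc _ _

/-- The canonical epimorphism from the free representation. -/
noncomputable def freeCoverπ [HasFiniteBiproducts A] (P : J ⥤ A) : freeCover P ⟶ P where
  app x := freeDesc P x
  naturality x y h := freeObj_hom_ext P fun z f => by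
    change freeι P f ≫ freeMap P h ≫ freeDesc P y = freeι P f ≫ freeDesc P x ≫ P.map h
    rw [← Category.assoc, freeι_map, freeι_desc, ← Category.assoc, freeι_desc, P.map_comp]

theorem isTraceSplit_of_projective [HasFiniteBiproducts A] (P : J ⥤ A) [Projective P] :
    IsTraceSplit P := by
  classical
  have hepi : Epi (freeCoverπ P) := by
    have : ∀ x, Epi ((freeCoverπ P).app x) := fun x => by
      have h : freeι P (𝟙 x) ≫ (freeCoverπ P).app x = 𝟙 _ :=
        (freeι_desc P (𝟙 x)).trans (P.map_id x)
      have : Epi (freeι P (𝟙 x) ≫ (freeCoverπ P).app x) := by rw [h]; infer_instance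
      exact epi_of_epi (freeι P (𝟙 x)) _
    exact NatTrans.epi_of_epi_app _
  let s : ∀ x, P.obj x ⟶ freeObj P x :=
    fun x => (Projective.factorThru (𝟙 P) (freeCoverπ P)).app x
  have hs : ∀ x, s x ≫ freeDesc P x = 𝟙 (P.obj x) := fun x =>
    congrArg (fun t => NatTrans.app t x) (Projective.factorThru_comp (𝟙 P) (freeCoverπ P))
  have hn : ∀ {x y : J} (h : x ⟶ y), P.map h ≫ s y = s x ≫ freeMap P h := fun h =>
    (Projective.factorThru (𝟙 P) (freeCoverπ P)).naturality h
  let q : ∀ (x : J) (a : Σ y : J, y ⟶ x), freeObj P x ⟶ P.obj a.1 :=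
    fun x a => biproduct.π (fun a : (Σ y : J, y ⟶ x) => P.obj a.1) a
  refine ⟨fun x => s x ≫ q x ⟨x, 𝟙 x⟩, fun x => ?_⟩
  let _ := Fintype.ofFinite (Σ y : J, y ⟶ x)
  have key : ∀ a : (Σ y : J, y ⟶ x), freeMap P (inv a.2) ≫ q a.1 ⟨a.1, 𝟙 a.1⟩ = q x a := by
    rintro ⟨y, f⟩
    refine freeObj_hom_ext P fun z g => ?_
    rw [← Category.assoc, freeι_map]
    by_cases hzy : (⟨z, g⟩ : Σ y : J, y ⟶ x) = ⟨y, f⟩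
    · cases hzy
      rw [IsIso.hom_inv_id]
      exact (biproduct.ι_π_self (fun a : (Σ z : J, z ⟶ y) => P.obj a.1) ⟨y, 𝟙 y⟩).trans
        (biproduct.ι_π_self (fun a : (Σ z : J, z ⟶ x) => P.obj a.1) ⟨y, f⟩).symm
    · have : (⟨z, g ≫ inv f⟩ : Σ z : J, z ⟶ y) ≠ ⟨y, 𝟙 y⟩ := by
        intro h
        apply hzy
        obtain ⟨rfl, h2⟩ := Sigma.mk.inj_iff.mp h
        have h3 : g ≫ inv f = 𝟙 _ := eq_of_heq h2
        have : g = f := by simpa using congrArg (· ≫ f) h3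
        rw [this]
      exact (biproduct.ι_π_ne (fun a : (Σ z : J, z ⟶ y) => P.obj a.1) this).trans
        (biproduct.ι_π_ne (fun a : (Σ z : J, z ⟶ x) => P.obj a.1) hzy).symm
  have h1 : ∀ a : (Σ y : J, y ⟶ x), P.map (inv a.2) ≫ (s a.1 ≫ q a.1 ⟨a.1, 𝟙 a.1⟩) ≫ P.map a.2 =
      s x ≫ q x a ≫ P.map a.2 := by
    intro a
    rw [← key a, Category.assoc, ← Category.assoc, hn, Category.assoc, Category.assoc]
  rw [Finset.sum_congr rfl fun a _ => h1 a, ← Preadditive.comp_sum]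
  refine Eq.trans ?_ (hs x)
  congr 1
  refine freeObj_hom_ext P fun y f => ?_
  rw [freeι_desc, Preadditive.comp_sum, Finset.sum_eq_single ⟨y, f⟩]
  · have h2 : freeι P f ≫ q x ⟨y, f⟩ = 𝟙 _ :=
      biproduct.ι_π_self (fun a : (Σ z : J, z ⟶ x) => P.obj a.1) ⟨y, f⟩
    rw [← Category.assoc, h2]
    exact Category.id_comp _
  · intro b _ hb
    have h2 : freeι P f ≫ q x b = 0 :=
      biproduct.ι_π_ne (fun a : (Σ z : J, z ⟶ x) => P.obj a.1) hb.symm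
    rw [← Category.assoc, h2, zero_comp]
  · exact fun h => (h (Finset.mem_univ _)).elim

theorem projective_of_isTraceSplit [HasPushouts A] (hA : ∀ V : A, Projective V) (P : J ⥤ A)
    (hP : IsTraceSplit P) : Projective P := by
  classical
  obtain ⟨θ, hθ⟩ := hP
  refine ⟨fun {E B} f e he => ?_⟩
  have he' : ∀ x, Epi (e.app x) := (NatTrans.epi_iff_epi_app e).mp he
  have := hA
  let l : ∀ x, P.obj x ⟶ E.obj x := fun x => Projective.factorThru (f.app x) (e.app x)
  have hl : ∀ x, l x ≫ e.app x = f.app x := fun x => Projective.factorThru_comp _ _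
  let _ : ∀ x : J, Fintype (Σ y : J, y ⟶ x) := fun x => Fintype.ofFinite _
  refine ⟨{ app := fun x => ∑ a : (Σ y : J, y ⟶ x),
              P.map (inv a.2) ≫ (θ a.1 ≫ l a.1) ≫ E.map a.2
            naturality := fun x x' h => ?_ }, ?_⟩
  · let q : (Σ y : J, y ⟶ x) ≃ (Σ y : J, y ⟶ x') :=
      { toFun := fun a => ⟨a.1, a.2 ≫ h⟩
        invFun := fun a => ⟨a.1, a.2 ≫ inv h⟩
        left_inv := fun a => by simp
        right_inv := fun a => by simp }
    rw [← q.sum_comp, Preadditive.comp_sum, Preadditive.sum_comp]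
    refine Finset.sum_congr rfl fun a _ => ?_
    simp [q]
  · ext x
    have h1 : ∀ a : (Σ y : J, y ⟶ x), (P.map (inv a.2) ≫ (θ a.1 ≫ l a.1) ≫ E.map a.2) ≫ e.app x
        = (P.map (inv a.2) ≫ θ a.1 ≫ P.map a.2) ≫ f.app x := by
      intro a
      simp [e.naturality, reassoc_of% hl]
    simp only [NatTrans.comp_app]
    rw [Preadditive.sum_comp, Finset.sum_congr rfl fun a _ => h1 a, ← Preadditive.sum_comp, hθ x,
      Category.id_comp]

theorem IsTraceSplit.comp_faithful (F : J ⥤ J') [F.Faithful] {P : J' ⥤ A} (hP : IsTraceSplit P) :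
    IsTraceSplit (F ⋙ P) := by
  classical
  obtain ⟨θ, hθ⟩ := hP
  let E : J → Type _ := fun w => Σ y : J', y ⟶ F.obj w
  let push : ∀ {w z : J} (_ : w ⟶ z), E w → E z := fun f e => ⟨e.1, e.2 ≫ F.map f⟩
  have push_id : ∀ w (e : E w), push (𝟙 w) e = e := fun w e => by simp [push]
  have push_comp : ∀ {w z t : J} (f : w ⟶ z) (g : z ⟶ t) (e : E w),
      push (f ≫ g) e = push g (push f e) := fun f g e => by simp [push]
  let S : Setoid (Σ w, E w) :=
    { r := fun a b => ∃ f : a.1 ⟶ b.1, push f a.2 = b.2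
      iseqv :=
        { refl := fun a => ⟨𝟙 _, push_id _ _⟩
          symm := fun {a b} ⟨f, hf⟩ => ⟨inv f, by rw [← hf, ← push_comp]; simp [push_id]⟩
          trans := fun {a b c} ⟨f, hf⟩ ⟨g, hg⟩ => ⟨f ≫ g, by rw [push_comp, hf, hg]⟩ } }
  let R : ∀ w, E w → Prop := fun w e => (Quotient.mk S ⟨w, e⟩).out = ⟨w, e⟩
  let _ : ∀ x : J, Fintype (Σ y : J, y ⟶ x) := fun x => Fintype.ofFinite _
  let _ : ∀ x : J', Fintype (Σ y : J', y ⟶ x) := fun x => Fintype.ofFinite _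
  let _ : ∀ x : J, Fintype {e : E x // R x e} := fun x => Fintype.ofFinite _
  let c : ∀ (z : J') (a : Σ y : J', y ⟶ z), P.obj z ⟶ P.obj z := fun z a =>
    P.map (inv a.2) ≫ θ a.1 ≫ P.map a.2
  refine ⟨fun w => ∑ e : {e : E w // R w e}, c _ e.1, fun z => ?_⟩
  let m : (Σ a : (Σ w : J, w ⟶ z), {e : E a.1 // R a.1 e}) → E z := fun b => push b.1.2 b.2.1
  have hm : Function.Bijective m := by
    constructor
    · rintro ⟨⟨w, f⟩, ⟨e, he⟩⟩ ⟨⟨w', f'⟩, ⟨e', he'⟩⟩ h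
      change push f e = push f' e' at h
      have h1 : Quotient.mk S ⟨w, e⟩ = Quotient.mk S ⟨w', e'⟩ := by
        apply Quotient.sound
        exact S.trans (b := ⟨z, push f e⟩) ⟨f, rfl⟩ (S.symm ⟨f', h.symm⟩)
      have h2 : (⟨w, e⟩ : Σ w, E w) = ⟨w', e'⟩ := by rw [← he, ← he', h1]
      cases h2
      have h3 : f = f' := by
        apply F.map_injective
        have := eq_of_heq (Sigma.mk.inj_iff.mp h).2
        simpa using congrArg (inv e.2 ≫ ·) this
      cases h3
      rfl
    · intro e
      let o := (Quotient.mk S ⟨z, e⟩).out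
      have ho : Quotient.mk S o = Quotient.mk S ⟨z, e⟩ := Quotient.out_eq _
      obtain ⟨f, hf⟩ : ∃ f : o.1 ⟶ z, push f o.2 = e := Quotient.exact ho
      refine ⟨⟨⟨o.1, f⟩, ⟨o.2, ?_⟩⟩, hf⟩
      change (Quotient.mk S o).out = o
      rw [ho]
  have h1 : ∀ a : (Σ w : J, w ⟶ z), (F ⋙ P).map (inv a.2) ≫
      (∑ e : {e : E a.1 // R a.1 e}, c _ e.1) ≫ (F ⋙ P).map a.2 =
      ∑ e : {e : E a.1 // R a.1 e}, c _ (m ⟨a, e⟩) := by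
    intro a
    rw [Preadditive.sum_comp, Preadditive.comp_sum]
    refine Finset.sum_congr rfl fun e _ => ?_
    simp [c, m, push]
  rw [Finset.sum_congr rfl fun a _ => h1 a]
  rw [← Fintype.sum_sigma' (fun a e => c _ (m ⟨a, e⟩))]
  have := (Equiv.ofBijective m hm).sum_comp (fun e => c _ e)
  exact this.trans (hθ (F.obj z))

/-- Restriction along a faithful functor between finite groupoids preserves projective
representations. -/
theorem projective_comp_faithful [HasFiniteBiproducts A] [HasPushouts A]
    (hA : ∀ V : A, Projective V) (F : J ⥤ J') [F.Faithful] (P : J' ⥤ A) [Projective P] :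
    Projective (F ⋙ P) :=
  projective_of_isTraceSplit hA _ ((isTraceSplit_of_projective P).comp_faithful F)
end Trace

section Stable
variable {C D : Type*} [Category* C] [Category* D] [Preadditive C] [Preadditive D]

variable (C) in
/-- Two morphisms are stably equal when their difference factors through a projective object. -/
def stableRel : HomRel C := fun X Y f g =>
  ∃ (P : C) (_ : Projective P) (a : X ⟶ P) (b : P ⟶ Y), f - g = a ≫ b

variable (C) in
/-- The stable category: the additive quotient of `C` by its projective objects. -/
abbrev Stab := Quotient (stableRel C)

variable (C) in
/-- The quotient functor to the stable category. -/
abbrev toStab : C ⥤ Stab C := Quotient.functor (stableRel C)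

theorem toStab_map_eq (F : C ⥤ D) [F.Additive] [F.PreservesProjectiveObjects] {X Y : C}
    {f g : X ⟶ Y} (h : stableRel C f g) :
    (toStab D).map (F.map f) = (toStab D).map (F.map g) := by
  obtain ⟨P, hP, a, b, hab⟩ := h
  exact CategoryTheory.Quotient.sound _ ⟨F.obj P, F.projective_obj_of_projective hP, F.map a, F.map b, by
    rw [← F.map_sub, hab, F.map_comp]⟩

/-- An additive functor that preserves projectives induces a functor on stable categories. -/
def stabMap (F : C ⥤ D) [F.Additive] [F.PreservesProjectiveObjects] : Stab C ⥤ Stab D :=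
  CategoryTheory.Quotient.lift _ (F ⋙ toStab D) fun _ _ _ _ h => toStab_map_eq F h

section Monoidal
theorem tensorLeft_preservesProjective {C : Type*} [Category* C] [MonoidalCategory C]
    [RigidCategory C] (X : C) : (tensorLeft X).PreservesProjectiveObjects :=
  have : (tensorLeft (ᘁX)).PreservesEpimorphisms :=
    Functor.preservesEpimorphisms_of_adjunction (tensorLeftAdjunction (ᘁ(ᘁX)) (ᘁX))
  Functor.preservesProjectiveObjects_of_adjunction_of_preservesEpimorphisms
    (tensorLeftAdjunction (ᘁX) X)

theorem tensorRight_preservesProjective {C : Type*} [Category* C] [MonoidalCategory C]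
    [RigidCategory C] (X : C) : (tensorRight X).PreservesProjectiveObjects :=
  have : (tensorRight (Xᘁ)).PreservesEpimorphisms :=
    Functor.preservesEpimorphisms_of_adjunction (tensorRightAdjunction (Xᘁ) ((Xᘁ)ᘁ))
  Functor.preservesProjectiveObjects_of_adjunction_of_preservesEpimorphisms
    (tensorRightAdjunction X (Xᘁ))

variable [MonoidalCategory C] [MonoidalPreadditive C]
  [∀ X : C, (tensorLeft X).PreservesProjectiveObjects]
  [∀ X : C, (tensorRight X).PreservesProjectiveObjects]

/-- The tensor product of the stable category, induced by that of `C`. -/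
instance : MonoidalCategoryStruct (Stab C) where
  tensorObj X Y := (toStab C).obj (X.as ⊗ Y.as)
  whiskerLeft X _ _ f := (stabMap (tensorLeft X.as)).map f
  whiskerRight f Y := (stabMap (tensorRight Y.as)).map f
  tensorHom {_ Y₁ X₂ _} f g :=
    (stabMap (tensorRight X₂.as)).map f ≫ (stabMap (tensorLeft Y₁.as)).map g
  tensorUnit := (toStab C).obj (𝟙_ C)
  associator X Y Z := (toStab C).mapIso (α_ X.as Y.as Z.as)
  leftUnitor X := (toStab C).mapIso (λ_ X.as)
  rightUnitor X := (toStab C).mapIso (ρ_ X.as)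

theorem toStab_whiskerLeft (X : C) {Y Z : C} (f : Y ⟶ Z) :
    (toStab C).obj X ◁ (toStab C).map f = (toStab C).map (X ◁ f) := rfl

theorem toStab_whiskerRight {Y Z : C} (f : Y ⟶ Z) (X : C) :
    (toStab C).map f ▷ (toStab C).obj X = (toStab C).map (f ▷ X) := rfl

theorem toStab_tensorHom {X Y Z T : C} (f : X ⟶ Y) (g : Z ⟶ T) :
    (toStab C).map f ⊗ₘ (toStab C).map g = (toStab C).map (f ⊗ₘ g) :=
  (congrArg (toStab C).map (MonoidalCategory.tensorHom_def f g)).symm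

instance : MonoidalCategory (Stab C) where
  tensorHom_def _ _ := rfl
  id_tensorHom_id X Y :=
    (toStab_tensorHom (𝟙 X.as) (𝟙 Y.as)).trans
      (congrArg (toStab C).map (id_tensorHom_id X.as Y.as))
  tensorHom_comp_tensorHom := by
    rintro _ _ _ _ _ _ ⟨f⟩ ⟨g⟩ ⟨h⟩ ⟨k⟩
    have e := congrArg (toStab C).map (tensorHom_comp_tensorHom f g h k)
    rw [Functor.map_comp, ← toStab_tensorHom, ← toStab_tensorHom, ← toStab_tensorHom] at e
    exact e
  whiskerLeft_id X Y := (stabMap (tensorLeft X.as)).map_id Y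
  id_whiskerRight X Y := (stabMap (tensorRight Y.as)).map_id X
  associator_naturality := by
    rintro _ _ _ _ _ _ ⟨f⟩ ⟨g⟩ ⟨h⟩
    have e := congrArg (toStab C).map (associator_naturality f g h)
    rw [Functor.map_comp, Functor.map_comp, ← toStab_tensorHom, ← toStab_tensorHom,
      ← toStab_tensorHom, ← toStab_tensorHom] at e
    exact e
  leftUnitor_naturality := by
    rintro _ _ ⟨f⟩
    exact congrArg (toStab C).map (leftUnitor_naturality f)
  rightUnitor_naturality := by
    rintro _ _ ⟨f⟩
    exact congrArg (toStab C).map (rightUnitor_naturality f)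
  pentagon W X Y Z :=
    congrArg (toStab C).map (pentagon W.as X.as Y.as Z.as)
  triangle X Y := congrArg (toStab C).map (triangle X.as Y.as)

variable [MonoidalCategory D] [MonoidalPreadditive D]
  [∀ X : D, (tensorLeft X).PreservesProjectiveObjects]
  [∀ X : D, (tensorRight X).PreservesProjectiveObjects]

open Functor in
instance (F : C ⥤ D) [F.Additive] [F.PreservesProjectiveObjects] [F.Monoidal] :
    (stabMap F).Monoidal :=
  CoreMonoidal.toMonoidal
    { εIso := (toStab D).mapIso (Monoidal.εIso F)
      μIso := fun X Y => (toStab D).mapIso (Monoidal.μIso F X.as Y.as)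
      μIso_hom_natural_left := by
        rintro X Y ⟨f⟩ Z
        exact congrArg (toStab D).map (LaxMonoidal.μ_natural_left F f Z.as)
      μIso_hom_natural_right := by
        rintro X Y Z ⟨f⟩
        exact congrArg (toStab D).map (LaxMonoidal.μ_natural_right F Z.as f)
      associativity := fun X Y Z =>
        congrArg (toStab D).map (LaxMonoidal.associativity F X.as Y.as Z.as)
      left_unitality := fun X =>
        congrArg (toStab D).map (LaxMonoidal.left_unitality F X.as)
      right_unitality := fun X =>
        congrArg (toStab D).map (LaxMonoidal.right_unitality F X.as) }

end Monoidal
end Stable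


section Endotrivial

theorem projective_fgModuleCat (k : Type u) [Field k] (V : FGModuleCat k) : Projective V where
  factors {E X} f e he := by
    have he' : Epi ((forget₂ (FGModuleCat k) (ModuleCat k)).map e) := inferInstance
    have hs : Function.Surjective e.hom.hom := (ModuleCat.epi_iff_surjective _).mp he'
    obtain ⟨s, hs⟩ := e.hom.hom.exists_rightInverse_of_surjective (LinearMap.range_eq_top.mpr hs)
    refine ⟨f ≫ FGModuleCat.ofHom s, ?_⟩
    ext x
    exact congrArg (fun t => t (f x)) hs

variable (k : Type u) [Field k] (G : Type v) [Group G]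

instance (V : FDRep k G) : (tensorLeft V).PreservesProjectiveObjects :=
  have : RigidCategory (FDRep k G) := BraidedCategory.rigidCategoryOfRightRigidCategory
  tensorLeft_preservesProjective V

instance (V : FDRep k G) : (tensorRight V).PreservesProjectiveObjects :=
  have : RigidCategory (FDRep k G) := BraidedCategory.rigidCategoryOfRightRigidCategory
  tensorRight_preservesProjective V

/-- The stable category of finitely generated `kG`-modules, with its tensor product over `k`. -/
abbrev StMod := Stab (FDRep k G)

/-- The group of endotrivial modules: the Picard group of isomorphism classes of tensor-invertible
objects of the stable category of finitely generated `kG`-modules. -/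
abbrev EndotrivialGroup := (Skeleton (StMod k G))ˣ

theorem aux_associativity {A : Type*} [Category* A] [MonoidalCategory A] (X Y Z : A) :
    𝟙 (X ⊗ Y) ▷ Z ≫ 𝟙 _ ≫ (α_ X Y Z).hom = (α_ X Y Z).hom ≫ X ◁ 𝟙 (Y ⊗ Z) ≫ 𝟙 _ := by
  simp

variable {G} (H : Subgroup G)

/-- Restriction of finitely generated modules from `G` to `H`. -/
abbrev resFD : FDRep k G ⥤ FDRep k H := Action.res (FGModuleCat k) H.subtype

instance : (resFD k H).Monoidal :=
  Functor.CoreMonoidal.toMonoidal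
    { εIso := Iso.refl _
      μIso := fun X Y => Iso.refl _
      μIso_hom_natural_left := fun f X => by
        ext1
        change f.hom ▷ X.V ≫ 𝟙 _ = 𝟙 _ ≫ f.hom ▷ X.V
        simp
      μIso_hom_natural_right := fun X f => by
        ext1
        change X.V ◁ f.hom ≫ 𝟙 _ = 𝟙 _ ≫ X.V ◁ f.hom
        simp
      associativity := fun X Y Z => by
        ext1
        change 𝟙 (X.V ⊗ Y.V) ▷ Z.V ≫ 𝟙 _ ≫ (α_ X Y Z).hom.hom =
          (α_ ((resFD k H).obj X) ((resFD k H).obj Y) ((resFD k H).obj Z)).hom.hom ≫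
            X.V ◁ 𝟙 (Y.V ⊗ Z.V) ≫ 𝟙 _
        rw [Action.associator_hom_hom, Action.associator_hom_hom]
        exact aux_associativity X.V Y.V Z.V
      left_unitality := fun X => by
        ext1
        change (λ_ ((resFD k H).obj X)).hom.hom =
          𝟙 (𝟙_ (FGModuleCat k)) ▷ X.V ≫ 𝟙 _ ≫ (λ_ X).hom.hom
        rw [Action.leftUnitor_hom_hom, Action.leftUnitor_hom_hom, id_whiskerRight]
        rfl
      right_unitality := fun X => by
        ext1
        change (ρ_ ((resFD k H).obj X)).hom.hom =
          X.V ◁ 𝟙 (𝟙_ (FGModuleCat k)) ≫ 𝟙 _ ≫ (ρ_ X).hom.hom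
        rw [Action.rightUnitor_hom_hom, Action.rightUnitor_hom_hom, whiskerLeft_id]
        rfl }

variable [Finite G]

instance {M : Type*} [Group M] [Finite M] (x : SingleObj M) :
    Finite (Σ y : SingleObj M, y ⟶ x) :=
  Finite.of_surjective (fun g : M => (⟨SingleObj.star M, g⟩ : Σ y : SingleObj M, y ⟶ x))
    fun a => ⟨a.2, rfl⟩

instance : (resFD k H).PreservesProjectiveObjects where
  projective_obj {P} hP := by
    have := HasFiniteBiproducts.of_hasFiniteProducts (C := FGModuleCat k)
    let F : SingleObj H ⥤ SingleObj G := SingleObj.mapHom _ _ H.subtype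
    have hF : F.Faithful := ⟨fun {_ _ a b} h => Subtype.ext h⟩
    have h1 : Projective ((Action.functorCategoryEquivalence (FGModuleCat k) G).functor.obj P) :=
      ((Action.functorCategoryEquivalence (FGModuleCat k) G).map_projective_iff P).mpr hP
    have h2 := projective_comp_faithful (projective_fgModuleCat k) F
      ((Action.functorCategoryEquivalence (FGModuleCat k) G).functor.obj P)
    exact ((Action.functorCategoryEquivalence (FGModuleCat k) H).map_projective_iff
      ((resFD k H).obj P)).mp h2

/-- The restriction homomorphism `T(G) → T(H)`. -/
noncomputable def resT : EndotrivialGroup k G →* EndotrivialGroup k H :=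
  Units.map (Skeleton.monoidHom (stabMap (resFD k H)))

/-- The kernel `T(G, H)` of restriction. -/
noncomputable abbrev EndotrivialKer : Subgroup (EndotrivialGroup k G) := (resT k H).ker

end Endotrivial

section GSets

variable {G : Type v} [Group G]

variable (G) in
/-- The category of finite `G`-sets. -/
abbrev GSet := Action FintypeCat.{v} G

variable (G) in
/-- A finite type with a `G`-action as an object of the category of finite `G`-sets. -/
abbrev gset (X : Type v) [MulAction G X] [Finite X] : GSet G :=
  @Action.FintypeCat.ofMulAction G (FintypeCat.of X) _ ‹MulAction G X›

/-- An equivariant map as a morphism of finite `G`-sets. -/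
def gsetHom {X Y : GSet G} (f : X.V → Y.V) (hf : ∀ (g : G) (x : X.V), f (g • x) = g • f x) :
    X ⟶ Y where
  hom := FintypeCat.homMk f
  comm g := by
    ext x
    exact hf g x

theorem gset_hom_smul {X Y : GSet G} (φ : X ⟶ Y) (g : G) (x : X.V) :
    φ.hom (g • x) = g • φ.hom x :=
  ConcreteCategory.congr_hom (φ.comm g) x

theorem gset_stabilizer_le {X Y : GSet G} (φ : X ⟶ Y) (x : X.V) :
    MulAction.stabilizer G x ≤ MulAction.stabilizer G (φ.hom x) := fun g hg => by
  rw [MulAction.mem_stabilizer_iff] at hg ⊢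
  rw [← gset_hom_smul, hg]

/-- A map `α : U ⟶ X` of finite `G`-sets is a sipp-cover when every `x` in `X` has a preimage `u`
such that the index of the stabilizer of `u` in the stabilizer of `x` is prime to `p`. -/
def IsSippCover (p : ℕ) {U X : GSet G} (α : U ⟶ X) : Prop :=
  ∀ x : X.V, ∃ u : U.V, α.hom u = x ∧
    ((MulAction.stabilizer G u).relIndex (MulAction.stabilizer G x)).Coprime p

/-- The projection `G/H ⟶ G/G`. -/
def orbitCover [Finite G] (H : Subgroup G) : gset G (G ⧸ H) ⟶ gset G (G ⧸ (⊤ : Subgroup G)) :=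
  gsetHom (Subgroup.quotientMapOfLE le_top) fun g x => by
    induction x using QuotientGroup.induction_on
    rfl

/-- The `n`-fold fibre product `U ×_X ⋯ ×_X U`, for `n ≥ 1`. -/
abbrev FibPow {U X : GSet G} (α : U ⟶ X) (n : ℕ) : Type v :=
  {u : Fin n → U.V // ∀ i j, α.hom (u i) = α.hom (u j)}

instance {U X : GSet G} (α : U ⟶ X) (n : ℕ) : MulAction G (FibPow α n) where
  smul g u := ⟨fun i => g • u.1 i, fun i j => by
    rw [gset_hom_smul, gset_hom_smul, u.2 i j]⟩
  one_smul u := Subtype.ext (funext fun i => one_smul G (u.1 i))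
  mul_smul g h u := Subtype.ext (funext fun i => mul_smul g h (u.1 i))

/-- The `n`-fold fibre product as a finite `G`-set. -/
abbrev fibPow {U X : GSet G} (α : U ⟶ X) (n : ℕ) : GSet G := gset G (FibPow α n)

/-- The `i`-th projection of the fibre product. -/
def fibProj {U X : GSet G} (α : U ⟶ X) {n : ℕ} (i : Fin n) : fibPow α n ⟶ U :=
  gsetHom (fun u : FibPow α n => u.1 i) fun _ _ => rfl

/-- The projection of the fibre product that omits the `i`-th factor. -/
def fibFace {U X : GSet G} (α : U ⟶ X) {n : ℕ} (i : Fin (n + 1)) :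
    fibPow α (n + 1) ⟶ fibPow α n :=
  gsetHom (fun u : FibPow α (n + 1) =>
    (⟨fun j => u.1 (i.succAbove j), fun _ _ => u.2 _ _⟩ : FibPow α n)) fun _ _ => rfl

end GSets

section Cech

variable {G : Type v} [Group G] (P : (GSet G)ᵒᵖ ⥤ AddCommGrpCat.{w}) {U X : GSet G} (α : U ⟶ X)

/-- The differential of the Čech complex, from degree `n`, where the group is the value of `P` at
the `(n + 1)`-fold fibre product, to degree `n + 1`. -/
noncomputable def cechD (n : ℕ) :
    P.obj (op (fibPow α (n + 1))) →+ P.obj (op (fibPow α (n + 2))) :=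
  ∑ i : Fin (n + 2), ((-1 : ℤ) ^ (i : ℕ)) • (P.map (fibFace α i).op).hom

/-- The coboundaries of the Čech complex. -/
noncomputable def cechB : ∀ n : ℕ, AddSubgroup (P.obj (op (fibPow α (n + 1))))
  | 0 => ⊥
  | n + 1 => (cechD P α n).range

/-- Čech cohomology: cocycles modulo coboundaries. -/
abbrev CechH (n : ℕ) : Type w :=
  (cechD P α n).ker ⧸ (cechB P α n).addSubgroupOf (cechD P α n).ker

/-- The cohomology class of a cocycle. -/
noncomputable def CechH.mk {P : (GSet G)ᵒᵖ ⥤ AddCommGrpCat.{w}} {U X : GSet G} {α : U ⟶ X}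
    {n : ℕ} (z : P.obj (op (fibPow α (n + 1)))) (hz : cechD P α n z = 0) :
    CechH P α n :=
  QuotientAddGroup.mk (⟨z, hz⟩ : (cechD P α n).ker)

end Cech

section Sheaves

variable {G : Type v} [Group G]

/-- The set of orbits of points whose stabilizer has order divisible by `p`. -/
def POrbits (p : ℕ) (X : GSet G) : Type v :=
  {o : MulAction.orbitRel.Quotient G X.V //
    ∃ x : X.V, Quotient.mk _ x = o ∧ p ∣ Nat.card (MulAction.stabilizer G x)}

/-- The orbit of a point whose stabilizer has order divisible by `p`. -/
def pOrbit {p : ℕ} {X : GSet G} (x : X.V) (hx : p ∣ Nat.card (MulAction.stabilizer G x)) :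
    POrbits p X :=
  ⟨Quotient.mk _ x, x, rfl, hx⟩

/-- Functoriality of the set of orbits with stabilizer of order divisible by `p`. -/
def POrbits.map {p : ℕ} {X Y : GSet G} (φ : X ⟶ Y) (o : POrbits p X) : POrbits p Y :=
  ⟨Quotient.map φ.hom (fun a b h => by
      obtain ⟨g, rfl⟩ := h
      exact ⟨g, (gset_hom_smul φ g b).symm⟩) o.1, by
    obtain ⟨x, hx, hp⟩ := o.2
    refine ⟨φ.hom x, by rw [← hx]; rfl, hp.trans ?_⟩
    exact Subgroup.card_dvd_of_le (gset_stabilizer_le φ x)⟩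

variable (G) in
/-- The constant sipp sheaf associated to an abelian group `A`: its value at `X` is the group of
functions from the set of orbits of `X` with stabilizer of order divisible by `p` to `A`. -/
def constSheaf (p : ℕ) (A : Type u) [AddCommGroup A] : (GSet G)ᵒᵖ ⥤ AddCommGrpCat.{max u v} where
  obj X := AddCommGrpCat.of (POrbits p X.unop → A)
  map φ := AddCommGrpCat.ofHom
    { toFun := fun c o => c (POrbits.map φ.unop o)
      map_zero' := rfl
      map_add' := fun _ _ => rfl }
  map_id X := by
    ext c o
    obtain ⟨o, ho⟩ := o
    induction o using Quotient.inductionOn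
    rfl
  map_comp φ ψ := by
    ext c o
    obtain ⟨o, ho⟩ := o
    induction o using Quotient.inductionOn
    rfl

variable (k : Type u) [Field k]

/-- Representations of the `G`-set `X`: functors from the action groupoid of `X` to vector
spaces. -/
abbrev GRep (X : GSet G) := ActionCategory G X.V ⥤ ModuleCat.{u} k

/-- The stable category of representations of `X`. -/
abbrev StRep (X : GSet G) := Stab (GRep k X)

/-- The functor of action groupoids induced by a map of `G`-sets. -/
def actionMap {X Y : GSet G} (φ : Y ⟶ X) : ActionCategory G Y.V ⥤ ActionCategory G X.V where
  obj y := ⟨(), φ.hom y.back⟩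
  map {y z} g := ⟨g.1, by
    have h : g.1 • y.back = z.back := g.2
    change g.1 • φ.hom y.back = φ.hom z.back
    rw [← gset_hom_smul, h]⟩
  map_id _ := rfl
  map_comp _ _ := rfl

instance {X Y : GSet G} (φ : Y ⟶ X) : (actionMap φ).Faithful where
  map_injective h := Subtype.ext (congrArg (fun t => (t.1 : G)) h)

/-- The pull-back of representations along a map of `G`-sets. -/
abbrev pull {X Y : GSet G} (φ : Y ⟶ X) : GRep k X ⥤ GRep k Y :=
  (Functor.whiskeringLeft _ _ _).obj (actionMap φ)

/-- The unit representation, with value `k` at every point and identity maps. -/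
abbrev unitRep (X : GSet G) : GRep k X := (Functor.const _).obj (ModuleCat.of k k)

/-- The unit representation as an object of the stable category. -/
abbrev stUnit (X : GSet G) : StRep k X := (toStab _).obj (unitRep k X)

instance (X : GSet G) : CommGroup (Aut (stUnit k X)) where
  mul_comm a b := by
    apply Iso.ext
    obtain ⟨f, hf⟩ := (toStab (GRep k X)).map_surjective a.hom
    obtain ⟨g, hg⟩ := (toStab (GRep k X)).map_surjective b.hom
    change b.hom ≫ a.hom = a.hom ≫ b.hom
    rw [← hf, ← hg, ← Functor.map_comp, ← Functor.map_comp]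
    congr 1
    ext x : 2
    change g.app x ≫ f.app x = f.app x ≫ g.app x
    refine ModuleCat.hom_ext (LinearMap.ext_ring ?_)
    change (f.app x).hom ((g.app x).hom (1 : k)) = (g.app x).hom ((f.app x).hom (1 : k))
    have hf' := (f.app x).hom.map_smul ((g.app x).hom (1 : k) : k) (1 : k)
    have hg' := (g.app x).hom.map_smul ((f.app x).hom (1 : k) : k) (1 : k)
    simp only [smul_eq_mul, mul_one] at hf' hg'
    rw [hf', hg']
    exact mul_comm (G := k) _ _

/-- The representation of `X` defined by a `kG`-module `V`: its value at every point is `V`, and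
the arrow given by `g` acts as `g` on `V`. It is the pull-back of `V`, seen as a representation of
the one-point `G`-set. -/
abbrev constRep (V : FDRep k G) (X : GSet G) : GRep k X :=
  ActionCategory.π G X.V ⋙ (Action.functorCategoryEquivalence (FGModuleCat k) G).functor.obj V ⋙
    forget₂ (FGModuleCat k) (ModuleCat k)

variable [Finite G]

instance (X : GSet G) (x : ActionCategory G X.V) : Finite (Σ y : ActionCategory G X.V, y ⟶ x) := by
  have h1 : Finite (ActionCategory G X.V) := Finite.of_equiv _ (ActionCategory.objEquiv G X.V)
  have h2 : ∀ y : ActionCategory G X.V, Finite (y ⟶ x) := fun y =>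
    Finite.of_injective (fun g : (y ⟶ x) => (g.1 : G)) fun _ _ h => Subtype.ext h
  infer_instance

instance (X : GSet G) : IsGroupoid (ActionCategory G X.V) where
  all_isIso {x y} g := by
    let g' : G := g.1
    have h : g' • x.back = y.back := g.2
    let i : y ⟶ x := ⟨g'⁻¹, by
      change g'⁻¹ • y.back = x.back
      rw [← h, inv_smul_smul]⟩
    exact ⟨i, Subtype.ext (inv_mul_cancel g'), Subtype.ext (mul_inv_cancel g')⟩

instance {X Y : GSet G} (φ : Y ⟶ X) : (pull k φ).PreservesProjectiveObjects where
  projective_obj {P} _ := projective_comp_faithful (fun _ => inferInstance) (actionMap φ) P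

/-- The pull-back of stable representations along a map of `G`-sets. -/
abbrev stPull {X Y : GSet G} (φ : Y ⟶ X) : StRep k X ⥤ StRep k Y := stabMap (pull k φ)

variable (G) in
/-- The presheaf of stable automorphisms of the unit representation, written additively. -/
def Gm : (GSet G)ᵒᵖ ⥤ AddCommGrpCat.{max u v} where
  obj X := AddCommGrpCat.of (Additive (Aut (stUnit k X.unop)))
  map {X Y} φ := AddCommGrpCat.ofHom
    (MonoidHom.toAdditive ((stPull k φ.unop).mapAut (stUnit k X.unop)))
  map_id X := by
    ext a
    refine congrArg Additive.ofMul (Iso.ext ?_)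
    obtain ⟨f, hf⟩ := (toStab (GRep k X.unop)).map_surjective (Additive.toMul a).hom
    change (stPull k (𝟙 X.unop)).map (Additive.toMul a).hom = (Additive.toMul a).hom
    rw [← hf]
    rfl
  map_comp {X Y Z} φ ψ := by
    ext a
    refine congrArg Additive.ofMul (Iso.ext ?_)
    obtain ⟨f, hf⟩ := (toStab (GRep k X.unop)).map_surjective (Additive.toMul a).hom
    change (stPull k (ψ.unop ≫ φ.unop)).map (Additive.toMul a).hom =
      (stPull k ψ.unop).map ((stPull k φ.unop).map (Additive.toMul a).hom)
    rw [← hf]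
    rfl

/-- The class of the representation defined by `V` in the stable category. -/
abbrev stConst (V : FDRep k G) (X : GSet G) : StRep k X := (toStab _).obj (constRep k V X)

/-- The pull-back of an isomorphism between `V` and the unit. -/
def pullTriv {k : Type u} [Field k] {X Y : GSet G} (φ : Y ⟶ X) {V : FDRep k G}
    (f : stConst k V X ≅ stUnit k X) : stConst k V Y ≅ stUnit k Y :=
  (stPull k φ).mapIso f

/-- For an isomorphism `f` between the pull-back of `V` to `U` and the unit in the stable category
of representations of `U`, the automorphism `pr₁^*(f) ∘ pr₂^*(f)⁻¹` of the unit over the two-fold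
fibre product of `U`. -/
def gluing {k : Type u} [Field k] {U X : GSet G} (α : U ⟶ X) {V : FDRep k G}
    (f : stConst k V U ≅ stUnit k U) : (Gm G k).obj (op (fibPow α 2)) :=
  Additive.ofMul (α := Aut (stUnit k (fibPow α 2)))
    ((pullTriv (fibProj α 1) f).symm ≪≫ pullTriv (fibProj α 0) f)

end Sheaves

end SippCech

open SippCech

/-! Higman's criterion turns stable statements into linear algebra. Over a field, a map of
representations of a finite groupoid factors through a projective exactly when it is a trace: over a
`G`-set `X`, a family `F x : V → W` of the form `∑ g, σ g ∘ θ (g⁻¹ • x) ∘ ρ g⁻¹` for arbitrary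
linear `θ` (`stableRel_iff_isTraceMap`, `toStab_map_eq_iff_isTrace`). A stable isomorphism is then a
pair of equivariant families `F`, `S`, inverse to each other modulo traces (`StablyInverse`). Traces
form a two-sided ideal, stable under pull-back, tensoring with equivariant families and summation
over a finite `G`-set.

For `V = W = k` the trace of a function `b` at `x` is the order of the stabilizer of `x` times the
sum of `b` over the orbit. It vanishes if `p` divides that order, and can take any value otherwise
(`isTrace_trivial_iff`). A stable endomorphism of the unit is thus a function on the orbits whose
stabilizers have order divisible by `p`, which is (i).

For (ii), let `U = G/H`. Conjugation by coset representatives identifies stable trivializations of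
`V` over `H` with those over `U` (`nonempty_stConst_iso_iff`). A trivialization `(F, S)` has
transition function `F x ∘ S y`. It is a cocycle because `S y ∘ F y` is stably the identity; another
trivialization, or a stably isomorphic module, changes it by a coboundary; tensor products multiply
it. This already defines a homomorphism to Čech cohomology.

Bijectivity rests on `|U|` being invertible in `k`. If the class vanishes, one rescales so that `F x
∘ S y` is stably `1`; then `F x` is stably independent of `x`, and its average over `U` is a stable
isomorphism over `G` (`StablyInverse.descend`). Conversely, a cocycle `c`, extended by zero to all
pairs, gives the equivariant endomorphism of `k^U` with matrix `|U|⁻¹ c`. It is idempotent modulo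
traces over `U`; a polynomial in it is a true idempotent in the same class, and the image of that
idempotent is the module sought (`exists_stablyInverse_of_cocycle`). Modules for `c` and `c⁻¹` are
inverse to each other, by the injectivity argument applied to their tensor products. -/

namespace SippCech

/-- A group is the product of a set of representatives of its left cosets and the subgroup. -/
noncomputable def quotientProdEquiv {G : Type*} [Group G] (H : Subgroup G) : (G ⧸ H) × H ≃ G :=
  Equiv.ofBijective (fun a => a.1.out * a.2) <| by
    constructor
    · rintro ⟨q, s⟩ ⟨q', s'⟩ h
      have h1 : ∀ (q : G ⧸ H) (s : H), ((q.out * s : G) : G ⧸ H) = q := fun q s => by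
        rw [QuotientGroup.mk_mul_of_mem _ s.2, QuotientGroup.out_eq']
      have h2 : q = q' := by
        rw [← h1 q s, ← h1 q' s']
        exact congrArg _ h
      subst h2
      exact congrArg _ (Subtype.ext (mul_left_cancel h))
    · intro g
      refine ⟨⟨(g : G ⧸ H), ⟨(g : G ⧸ H).out⁻¹ * g, ?_⟩⟩, mul_inv_cancel_left _ _⟩
      rw [← QuotientGroup.eq, QuotientGroup.out_eq']

theorem quotientProdEquiv_apply {G : Type*} [Group G] (H : Subgroup G) (q : G ⧸ H) (s : H) :
    quotientProdEquiv H (q, s) = q.out * s := rfl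

/-! ### Equivariant families over a `G`-set and the ideal of traces -/

section Families

variable {k : Type*} [Field k] {G : Type*} [Group G]
variable {X Y : Type*} [MulAction G X] [MulAction G Y]
variable {V W Z : Type*} [AddCommGroup V] [Module k V] [AddCommGroup W] [Module k W]
  [AddCommGroup Z] [Module k Z]
variable {ρ : Representation k G V} {σ : Representation k G W} {τ : Representation k G Z}

/-- A family of linear maps indexed by a `G`-set that commutes with the action of `G`. -/
def IsEquivariant (ρ : Representation k G V) (σ : Representation k G W)
    (F : X → V →ₗ[k] W) : Prop :=
  ∀ (g : G) (x : X), F (g • x) ∘ₗ ρ g = σ g ∘ₗ F x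

/-- A family of linear maps that is the trace of some family. -/
def IsTrace [Fintype G] (ρ : Representation k G V) (σ : Representation k G W)
    (F : X → V →ₗ[k] W) : Prop :=
  ∃ θ : X → V →ₗ[k] W, ∀ x, F x = ∑ g : G, σ g ∘ₗ θ (g⁻¹ • x) ∘ₗ ρ g⁻¹

theorem comp_fintype_sum {ι : Type*} [Fintype ι] (f : W →ₗ[k] Z) (g : ι → V →ₗ[k] W) :
    f ∘ₗ (∑ i, g i) = ∑ i, f ∘ₗ g i :=
  map_sum (LinearMap.compRight k f) _ _

theorem fintype_sum_comp {ι : Type*} [Fintype ι] (f : ι → W →ₗ[k] Z) (g : V →ₗ[k] W) :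
    (∑ i, f i) ∘ₗ g = ∑ i, f i ∘ₗ g :=
  map_sum (LinearMap.lcomp k Z g) _ _

theorem rho_comp_inv (ρ : Representation k G V) (g : G) : ρ g ∘ₗ ρ g⁻¹ = LinearMap.id := by
  rw [← Module.End.mul_eq_comp, ← map_mul, mul_inv_cancel, map_one]; rfl

namespace IsEquivariant

theorem id : IsEquivariant ρ ρ (fun _ : X => LinearMap.id) := fun _ _ => rfl

theorem comp {E : X → W →ₗ[k] Z} {F : X → V →ₗ[k] W} (hE : IsEquivariant σ τ E)
    (hF : IsEquivariant ρ σ F) : IsEquivariant ρ τ (fun x => E x ∘ₗ F x) := fun g x => by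
  rw [LinearMap.comp_assoc, hF, ← LinearMap.comp_assoc, hE, LinearMap.comp_assoc]

theorem pull {F : X → V →ₗ[k] W} (hF : IsEquivariant ρ σ F) (φ : Y → X)
    (hφ : ∀ (g : G) y, φ (g • y) = g • φ y) : IsEquivariant ρ σ (fun y => F (φ y)) := fun g y => by
  beta_reduce
  rw [hφ, hF]

theorem smul {F : X → V →ₗ[k] W} (hF : IsEquivariant ρ σ F) (a : X → k)
    (ha : ∀ (g : G) x, a (g • x) = a x) : IsEquivariant ρ σ (fun x => a x • F x) := fun g x => by
  beta_reduce
  rw [ha, LinearMap.smul_comp, hF, LinearMap.comp_smul]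

theorem sum_fiber [Fintype Y] {F : X × Y → V →ₗ[k] W} (hF : IsEquivariant ρ σ F) :
    IsEquivariant ρ σ (fun x => ∑ y, F (x, y)) := fun g x => by
  beta_reduce
  rw [fintype_sum_comp, comp_fintype_sum, ← Equiv.sum_comp (MulAction.toPerm g)]
  exact Finset.sum_congr rfl fun y _ => hF g (x, y)

theorem apply_smul {F : X → V →ₗ[k] W} (hF : IsEquivariant ρ σ F) (g : G) (x : X) :
    F (g • x) = σ g ∘ₗ F x ∘ₗ ρ g⁻¹ := by
  rw [← LinearMap.comp_assoc, ← hF, LinearMap.comp_assoc, rho_comp_inv, LinearMap.comp_id]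

theorem tensor {V' W' : Type*} [AddCommGroup V'] [Module k V'] [AddCommGroup W'] [Module k W']
    {ρ' : Representation k G V'} {σ' : Representation k G W'}
    {F : X → V →ₗ[k] W} {F' : X → V' →ₗ[k] W'} (hF : IsEquivariant ρ σ F)
    (hF' : IsEquivariant ρ' σ' F') :
    IsEquivariant (ρ.tprod ρ') (σ.tprod σ') (fun x => TensorProduct.map (F x) (F' x)) :=
  fun g x => by
    rw [Representation.tprod_apply, Representation.tprod_apply, ← TensorProduct.map_comp,
      ← TensorProduct.map_comp, hF, hF']

end IsEquivariant

namespace IsTrace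

variable [Fintype G]

theorem zero : IsTrace ρ σ (fun _ : X => (0 : V →ₗ[k] W)) := ⟨fun _ => 0, by simp⟩

theorem add {F E : X → V →ₗ[k] W} (hF : IsTrace ρ σ F) (hE : IsTrace ρ σ E) :
    IsTrace ρ σ (fun x => F x + E x) := by
  obtain ⟨θ, hθ⟩ := hF
  obtain ⟨η, hη⟩ := hE
  refine ⟨fun x => θ x + η x, fun x => ?_⟩
  beta_reduce
  rw [hθ, hη, ← Finset.sum_add_distrib]
  simp only [LinearMap.add_comp, LinearMap.comp_add]

theorem const_smul {F : X → V →ₗ[k] W} (hF : IsTrace ρ σ F) (c : k) :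
    IsTrace ρ σ (fun x => c • F x) := by
  obtain ⟨θ, hθ⟩ := hF
  refine ⟨fun x => c • θ x, fun x => ?_⟩
  beta_reduce
  rw [hθ, Finset.smul_sum]
  simp only [LinearMap.smul_comp, LinearMap.comp_smul]

theorem neg {F : X → V →ₗ[k] W} (hF : IsTrace ρ σ F) : IsTrace ρ σ (fun x => - F x) := by
  simpa using hF.const_smul (-1)

theorem sub_comm {F E : X → V →ₗ[k] W} (h : IsTrace ρ σ (fun x => F x - E x)) :
    IsTrace ρ σ (fun x => E x - F x) := by
  simpa using h.neg

theorem sub_trans {D E F : X → V →ₗ[k] W} (h : IsTrace ρ σ (fun x => D x - E x))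
    (h' : IsTrace ρ σ (fun x => E x - F x)) : IsTrace ρ σ (fun x => D x - F x) := by
  simpa using h.add h'

/-- An equivariant factor can be moved past each `σ g` into `θ`. With `comp_right`, this makes
traces a two-sided ideal. -/
theorem comp_left {F : X → V →ₗ[k] W} (hF : IsTrace ρ σ F) {E : X → W →ₗ[k] Z}
    (hE : IsEquivariant σ τ E) : IsTrace ρ τ (fun x => E x ∘ₗ F x) := by
  obtain ⟨θ, hθ⟩ := hF
  refine ⟨fun x => E x ∘ₗ θ x, fun x => ?_⟩
  beta_reduce
  rw [hθ, comp_fintype_sum]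
  refine Finset.sum_congr rfl fun g _ => ?_
  have h := hE g (g⁻¹ • x)
  rw [smul_inv_smul] at h
  rw [← LinearMap.comp_assoc, h]
  rfl

theorem comp_right {E : X → W →ₗ[k] Z} (hE : IsTrace σ τ E) {F : X → V →ₗ[k] W}
    (hF : IsEquivariant ρ σ F) : IsTrace ρ τ (fun x => E x ∘ₗ F x) := by
  obtain ⟨θ, hθ⟩ := hE
  refine ⟨fun x => θ x ∘ₗ F x, fun x => ?_⟩
  beta_reduce
  rw [hθ, fintype_sum_comp]
  refine Finset.sum_congr rfl fun g _ => ?_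
  have h := hF g⁻¹ x
  rw [LinearMap.comp_assoc, LinearMap.comp_assoc, ← h]
  rfl

/-- `E F - E' F' = (E - E') F + E' (F - F')`, so only `E'` and `F` have to be equivariant. -/
theorem comp_sub_comp {E E' : X → W →ₗ[k] Z} {F F' : X → V →ₗ[k] W}
    (hE : IsTrace σ τ (fun x => E x - E' x)) (hF : IsTrace ρ σ (fun x => F x - F' x))
    (eE' : IsEquivariant σ τ E') (eF : IsEquivariant ρ σ F) :
    IsTrace ρ τ (fun x => E x ∘ₗ F x - E' x ∘ₗ F' x) := by
  have h := (hE.comp_right eF).add (hF.comp_left eE')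
  simpa [LinearMap.sub_comp, LinearMap.comp_sub] using h

theorem pull {F : X → V →ₗ[k] W} (hF : IsTrace ρ σ F) (φ : Y → X)
    (hφ : ∀ (g : G) y, φ (g • y) = g • φ y) : IsTrace ρ σ (fun y => F (φ y)) := by
  obtain ⟨θ, hθ⟩ := hF
  exact ⟨fun y => θ (φ y), fun y => by simp only [hθ, hφ]⟩

/-- Push-forward along `X × Y → X` commutes with traces, because `g⁻¹` permutes `Y`. -/
theorem sum_fiber [Fintype Y] {F : X × Y → V →ₗ[k] W} (hF : IsTrace ρ σ F) :
    IsTrace ρ σ (fun x => ∑ y, F (x, y)) := by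
  obtain ⟨θ, hθ⟩ := hF
  refine ⟨fun x => ∑ y, θ (x, y), fun x => ?_⟩
  simp only [hθ]
  rw [Finset.sum_comm]
  refine Finset.sum_congr rfl fun g _ => ?_
  rw [fintype_sum_comp, comp_fintype_sum, ← Equiv.sum_comp (MulAction.toPerm g)]
  refine Finset.sum_congr rfl fun y _ => ?_
  simp

/-- Projection formula: an equivariant `F'` is fixed by conjugation, so `Tr(θ) ⊗ F' = Tr(θ ⊗ F')`.
-/
theorem tensor_right {V' W' : Type*} [AddCommGroup V'] [Module k V'] [AddCommGroup W']
    [Module k W'] {ρ' : Representation k G V'} {σ' : Representation k G W'}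
    {F : X → V →ₗ[k] W} {F' : X → V' →ₗ[k] W'} (hF : IsTrace ρ σ F)
    (hF' : IsEquivariant ρ' σ' F') :
    IsTrace (ρ.tprod ρ') (σ.tprod σ') (fun x => TensorProduct.map (F x) (F' x)) := by
  obtain ⟨θ, hθ⟩ := hF
  refine ⟨fun x => TensorProduct.map (θ x) (F' x), fun x => ?_⟩
  have h : ∀ g : G, σ'  g ∘ₗ F' (g⁻¹ • x) ∘ₗ ρ' g⁻¹ = F' x := fun g => by
    rw [← hF'.apply_smul, smul_inv_smul]
  beta_reduce
  rw [hθ]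
  simp only [Representation.tprod_apply, ← TensorProduct.map_comp, h]
  refine TensorProduct.ext' fun v v' => ?_
  simp only [TensorProduct.map_tmul, LinearMap.sum_apply, TensorProduct.sum_tmul]

theorem tensor_left {V' W' : Type*} [AddCommGroup V'] [Module k V'] [AddCommGroup W']
    [Module k W'] {ρ' : Representation k G V'} {σ' : Representation k G W'}
    {F : X → V →ₗ[k] W} {F' : X → V' →ₗ[k] W'} (hF : IsEquivariant ρ σ F)
    (hF' : IsTrace ρ' σ' F') :
    IsTrace (ρ.tprod ρ') (σ.tprod σ') (fun x => TensorProduct.map (F x) (F' x)) := by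
  obtain ⟨θ, hθ⟩ := hF'
  refine ⟨fun x => TensorProduct.map (F x) (θ x), fun x => ?_⟩
  have h : ∀ g : G, σ g ∘ₗ F (g⁻¹ • x) ∘ₗ ρ g⁻¹ = F x := fun g => by
    rw [← hF.apply_smul, smul_inv_smul]
  beta_reduce
  rw [hθ]
  simp only [Representation.tprod_apply, ← TensorProduct.map_comp, h]
  refine TensorProduct.ext' fun v v' => ?_
  simp only [TensorProduct.map_tmul, LinearMap.sum_apply, TensorProduct.tmul_sum]

end IsTrace

theorem IsEquivariant.apply_one {F : X → k →ₗ[k] k}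
    (hF : IsEquivariant (Representation.trivial k G k) (Representation.trivial k G k) F)
    (g : G) (x : X) : F (g • x) 1 = F x 1 :=
  congrArg (fun t : k →ₗ[k] k => t 1) (hF g x)

/-! ### Traces of scalar functions and stabilizers of order divisible by `p` -/

section Scalars

variable [Fintype G] {p : ℕ} [CharP k p]

/-- Each coset of the stabilizer contributes the same value as many times as the stabilizer has
elements, that is, zero in `k`. -/
theorem sum_smul_eq_zero (t : X → k) (x : X) (hx : p ∣ Nat.card (MulAction.stabilizer G x)) :
    ∑ g : G, t (g • x) = 0 := by
  classical
  rw [← (quotientProdEquiv (MulAction.stabilizer G x)).sum_comp, Fintype.sum_prod_type]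
  refine Finset.sum_eq_zero fun q _ => ?_
  have h : ∀ s : MulAction.stabilizer G x,
      quotientProdEquiv (MulAction.stabilizer G x) (q, s) • x = q.out • x := fun s => by
    rw [quotientProdEquiv_apply, mul_smul, s.2]
  simp only [h]
  rw [Finset.sum_const, Finset.card_univ, ← Nat.card_eq_fintype_card, nsmul_eq_mul,
    (CharP.cast_eq_zero_iff k p _).mpr hx, zero_mul]

theorem exists_sum_smul (a : X → k) (ha : ∀ (g : G) x, a (g • x) = a x)
    (h0 : ∀ x, p ∣ Nat.card (MulAction.stabilizer G x) → a x = 0) :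
    ∃ b : X → k, ∀ x, a x = ∑ g : G, b (g⁻¹ • x) := by
  classical
  let r : X → X := fun x => (Quotient.mk (MulAction.orbitRel G X) x).out
  have hr : ∀ x, ∃ g : G, g • r x = x := fun x => by
    have h : (MulAction.orbitRel G X).r (r x) x := Quotient.mk_out (s := MulAction.orbitRel G X) x
    obtain ⟨g, hg⟩ := h
    exact ⟨g⁻¹, by rw [← hg]; simp⟩
  have hr' : ∀ (g : G) x, r (g • x) = r x := fun g x => by
    have : Quotient.mk (MulAction.orbitRel G X) (g • x) = Quotient.mk _ x :=
      Quotient.sound ⟨g, rfl⟩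
    simp only [r, this]
  -- `b` lives on the chosen representative of each orbit. The sum over `G` meets this point once
  -- for each element of its stabilizer, hence the denominator. If the denominator is zero in `k`,
  -- then `a` vanishes on the orbit and division by zero gives the required `0`.
  refine ⟨fun y => if y = r y then a y / Nat.card (MulAction.stabilizer G y) else 0, fun x => ?_⟩
  obtain ⟨h, hh⟩ := hr x
  rw [← Equiv.sum_comp (Equiv.inv G), ← Equiv.sum_comp (Equiv.mulRight h⁻¹)]
  have h1 : ∀ g : G, ((Equiv.inv G) ((Equiv.mulRight h⁻¹) g))⁻¹ • x = g • r x := fun g => by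
    nth_rw 1 [← hh]
    simp [mul_smul]
  have h2 : ∀ g : G, r (g • r x) = r x := fun g => by rw [hr', ← hr' h, hh]
  simp only [h1, h2]
  have h3 : ∀ g : G, (if g • r x = r x then a (g • r x) /
      (Nat.card (MulAction.stabilizer G (g • r x)) : k) else 0) =
      if g • r x = r x then a x / (Nat.card (MulAction.stabilizer G (r x)) : k) else 0 :=
    fun g => by
      split_ifs with hg
      · rw [hg, ← ha h (r x), hh]
      · rfl
  simp only [h3]
  rw [← Finset.sum_filter, Finset.sum_const, nsmul_eq_mul]
  have h4 : (Finset.univ.filter fun g : G => g • r x = r x).card =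
      Nat.card (MulAction.stabilizer G (r x)) := by
    rw [Nat.card_eq_fintype_card, Fintype.card_subtype]
    rfl
  rw [h4]
  by_cases hp : p ∣ Nat.card (MulAction.stabilizer G (r x))
  · have := h0 _ hp
    rw [← ha h, hh] at this
    simp [this]
  · rw [mul_div_cancel₀]
    rwa [Ne, CharP.cast_eq_zero_iff k p]

/-- The scalar `a` is itself the trace of some `b`, and by the projection formula `a • F` is the
trace of `b • F`. This is the source of all nontrivial traces in the descent arguments: identities
between scalars are needed only where `p` divides the stabilizer. -/
theorem IsEquivariant.isTrace_smul {F : X → V →ₗ[k] W} (hF : IsEquivariant ρ σ F)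
    (p : ℕ) [CharP k p] (a : X → k)
    (ha : ∀ (g : G) x, a (g • x) = a x)
    (h0 : ∀ x, p ∣ Nat.card (MulAction.stabilizer G x) → a x = 0) :
    IsTrace ρ σ (fun x => a x • F x) := by
  obtain ⟨b, hb⟩ := exists_sum_smul (p := p) a ha h0
  refine ⟨fun x => b x • F x, fun x => ?_⟩
  beta_reduce
  rw [hb, Finset.sum_smul]
  refine Finset.sum_congr rfl fun g _ => ?_
  rw [LinearMap.smul_comp, LinearMap.comp_smul, ← hF.apply_smul, smul_inv_smul]

theorem isTrace_trivial_iff (p : ℕ) [CharP k p] {F : X → k →ₗ[k] k}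
    (hF : IsEquivariant (Representation.trivial k G k) (Representation.trivial k G k) F) :
    IsTrace (Representation.trivial k G k) (Representation.trivial k G k) F ↔
      ∀ x, p ∣ Nat.card (MulAction.stabilizer G x) → F x 1 = 0 := by
  constructor
  · rintro ⟨θ, hθ⟩ x hx
    rw [hθ, ← Equiv.sum_comp (Equiv.inv G), LinearMap.sum_apply]
    have := sum_smul_eq_zero (fun y => θ y 1) x hx
    simpa using this
  · intro h
    have := (IsEquivariant.id (X := X) (ρ := Representation.trivial k G k)).isTrace_smul p
      (fun x => F x 1) hF.apply_one h
    convert this using 2 with x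
    exact LinearMap.ext_ring (by simp)

end Scalars

end Families

/-! ### Stable inverses and descent by averaging -/

section StableInverse

variable {k : Type*} [Field k] {G : Type*} [Group G]
variable {X Y : Type*} [MulAction G X] [MulAction G Y]
variable {V W Z : Type*} [AddCommGroup V] [Module k V] [AddCommGroup W] [Module k W]
  [AddCommGroup Z] [Module k Z]
variable {ρ : Representation k G V} {σ : Representation k G W} {τ : Representation k G Z}

/-- The average of a family over a finite set. -/
noncomputable def average [Fintype X] (F : X → V →ₗ[k] W) : V →ₗ[k] W :=
  (Fintype.card X : k)⁻¹ • ∑ x, F x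

theorem average_const [Fintype X] (hX : (Fintype.card X : k) ≠ 0) (E : V →ₗ[k] W) :
    average (fun _ : X => E) = E := by
  rw [average, Finset.sum_const, Finset.card_univ, ← Nat.cast_smul_eq_nsmul k, smul_smul,
    inv_mul_cancel₀ hX, one_smul]

theorem average_sub [Fintype X] (E F : X → V →ₗ[k] W) :
    average (fun x => E x - F x) = average E - average F := by
  rw [average, average, average, Finset.sum_sub_distrib, smul_sub]

theorem IsEquivariant.average [Fintype X] {F : X → V →ₗ[k] W} (hF : IsEquivariant ρ σ F) :
    IsEquivariant ρ σ (fun _ : Y => average F) := fun g x => by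
  have h1 := (hF.pull (Prod.snd : Y × X → X) fun _ _ => rfl).sum_fiber
  exact h1.smul (fun _ => (Fintype.card X : k)⁻¹) (fun _ _ => rfl) g x

variable [Fintype G]

/-- Two families of linear maps that are equivariant and inverse to each other modulo traces. -/
structure StablyInverse (ρ : Representation k G V) (σ : Representation k G W)
    (F : X → V →ₗ[k] W) (S : X → W →ₗ[k] V) : Prop where
  left : IsEquivariant ρ σ F
  right : IsEquivariant σ ρ S
  right_left : IsTrace ρ ρ (fun x => S x ∘ₗ F x - LinearMap.id)
  left_right : IsTrace σ σ (fun x => F x ∘ₗ S x - LinearMap.id)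

namespace IsTrace

theorem self (F : X → V →ₗ[k] W) : IsTrace ρ σ (fun x => F x - F x) := by
  simpa using IsTrace.zero

theorem comp_sub_left {F F' : X → V →ₗ[k] W} (hF : IsTrace ρ σ (fun x => F x - F' x))
    {E : X → W →ₗ[k] Z} (hE : IsEquivariant σ τ E) :
    IsTrace ρ τ (fun x => E x ∘ₗ F x - E x ∘ₗ F' x) := by
  simpa [LinearMap.comp_sub] using hF.comp_left hE

theorem comp_sub_right {E E' : X → W →ₗ[k] Z} (hE : IsTrace σ τ (fun x => E x - E' x))
    {F : X → V →ₗ[k] W} (hF : IsEquivariant ρ σ F) :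
    IsTrace ρ τ (fun x => E x ∘ₗ F x - E' x ∘ₗ F x) := by
  simpa [LinearMap.sub_comp] using hE.comp_right hF

end IsTrace

namespace StablyInverse

variable {F : X → V →ₗ[k] W} {S : X → W →ₗ[k] V}

theorem pull (h : StablyInverse ρ σ F S) (φ : Y → X) (hφ : ∀ (g : G) y, φ (g • y) = g • φ y) :
    StablyInverse ρ σ (fun y => F (φ y)) (fun y => S (φ y)) :=
  ⟨h.left.pull φ hφ, h.right.pull φ hφ, h.right_left.pull φ hφ, h.left_right.pull φ hφ⟩

theorem comp (h : StablyInverse ρ σ F S) {E : X → W →ₗ[k] Z} {T : X → Z →ₗ[k] W}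
    (h' : StablyInverse σ τ E T) :
    StablyInverse ρ τ (fun x => E x ∘ₗ F x) (fun x => S x ∘ₗ T x) where
  left := h'.left.comp h.left
  right := h.right.comp h'.right
  right_left := ((h'.right_left.comp_sub_right h.left).comp_sub_left h.right).sub_trans
    h.right_left
  left_right := ((h.left_right.comp_sub_right h'.right).comp_sub_left h'.left).sub_trans
    h'.left_right

theorem tensor {V' W' : Type*} [AddCommGroup V'] [Module k V'] [AddCommGroup W'] [Module k W']
    {ρ' : Representation k G V'} {σ' : Representation k G W'}
    (h : StablyInverse ρ σ F S) {F' : X → V' →ₗ[k] W'} {S' : X → W' →ₗ[k] V'}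
    (h' : StablyInverse ρ' σ' F' S') :
    StablyInverse (ρ.tprod ρ') (σ.tprod σ') (fun x => TensorProduct.map (F x) (F' x))
      (fun x => TensorProduct.map (S x) (S' x)) where
  left := h.left.tensor h'.left
  right := h.right.tensor h'.right
  right_left := by
    have h1 := (h.right_left.tensor_right (h'.right.comp h'.left)).add
      (h'.right_left.tensor_left IsEquivariant.id)
    convert h1 using 2 with x
    refine TensorProduct.ext' fun v w => ?_
    simp [TensorProduct.sub_tmul, TensorProduct.tmul_sub]
  left_right := by
    have h1 := (h.left_right.tensor_right (h'.left.comp h'.right)).add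
      (h'.left_right.tensor_left IsEquivariant.id)
    convert h1 using 2 with x
    refine TensorProduct.ext' fun v w => ?_
    simp [TensorProduct.sub_tmul, TensorProduct.tmul_sub]

end StablyInverse

theorem IsTrace.average [Fintype X] {F : X → V →ₗ[k] W} (hF : IsTrace ρ σ F) :
    IsTrace ρ σ (fun _ : Y => average F) :=
  (hF.pull (Prod.snd : Y × X → X) fun _ _ => rfl).sum_fiber.const_smul _

/-- Traces descend along a `G`-set of cardinality invertible in `k`. -/
theorem IsTrace.of_const [Fintype X] (hX : (Fintype.card X : k) ≠ 0) {E : V →ₗ[k] W}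
    (hE : IsTrace ρ σ (fun _ : X => E)) : IsTrace ρ σ (fun _ : Y => E) := by
  have := hE.average (Y := Y)
  rwa [average_const hX] at this

/-- Averaging `F x - F y` over `y` gives `F x` minus the average, and averages of traces are traces.
-/
theorem IsTrace.sub_average [Fintype X] (hX : (Fintype.card X : k) ≠ 0) {F : X → V →ₗ[k] W}
    (hF : IsTrace ρ σ (fun x : X × X => F x.1 - F x.2)) :
    IsTrace ρ σ (fun x => F x - SippCech.average F) := by
  have h1 := hF.sum_fiber.const_smul (Fintype.card X : k)⁻¹
  convert h1 using 2 with x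
  change _ = SippCech.average (fun y => F x - F y)
  rw [average_sub, average_const hX]

/-- Stable isomorphisms descend along a `G`-set of cardinality invertible in `k`. -/
theorem StablyInverse.descend [Fintype X] (hX : (Fintype.card X : k) ≠ 0) {F : X → V →ₗ[k] W}
    {S : X → W →ₗ[k] V} (h : StablyInverse ρ σ F S)
    (hF : IsTrace ρ σ (fun x : X × X => F x.1 - F x.2)) :
    StablyInverse ρ σ (fun _ : Y => average F) (fun _ : Y => average S) := by
  have h1 := h.pull (Prod.fst : X × X → X) fun _ _ => rfl
  have h2 := h.pull (Prod.snd : X × X → X) fun _ _ => rfl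
  -- Uniqueness of inverses: modulo traces, `S x = S x F y S y = S x F x S y = S y`.
  have hS : IsTrace σ ρ (fun x : X × X => S x.1 - S x.2) := by
    have a1 := (h2.left_right.comp_sub_left h1.right).sub_comm
    have a2 := (hF.sub_comm.comp_sub_right h2.right).comp_sub_left h1.right
    have a3 := h1.right_left.comp_sub_right h2.right
    exact (a1.sub_trans a2).sub_trans a3
  have hF' := hF.sub_average hX
  have hS' := hS.sub_average hX
  -- The two composites of averages do not depend on the point, so it suffices to compare them with
  -- the identity over `X`, where each average is congruent to the original family.
  refine ⟨h.left.average, h.right.average, IsTrace.of_const hX ?_, IsTrace.of_const hX ?_⟩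
  · exact (hS'.comp_sub_comp hF' h.right.average h.left).sub_comm.sub_trans h.right_left
  · exact (hF'.comp_sub_comp hS' h.left.average h.right).sub_comm.sub_trans h.left_right

section Trivial

variable (p : ℕ) [CharP k p]
variable {F : X → V →ₗ[k] k} {S : X → k →ₗ[k] V}

theorem isTrace_sub_iff {a b : X → k →ₗ[k] k}
    (ha : IsEquivariant (Representation.trivial k G k) (Representation.trivial k G k) a)
    (hb : IsEquivariant (Representation.trivial k G k) (Representation.trivial k G k) b) :
    IsTrace (Representation.trivial k G k) (Representation.trivial k G k)
      (fun x => a x - b x) ↔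
      ∀ x, p ∣ Nat.card (MulAction.stabilizer G x) → a x 1 = b x 1 := by
  rw [isTrace_trivial_iff p]
  · simp only [LinearMap.sub_apply, sub_eq_zero]
  · intro g x
    beta_reduce
    rw [LinearMap.sub_comp, LinearMap.comp_sub, ha, hb]

/-- The transition function of a stable trivialization, evaluated on a cocycle triple. -/
theorem StablyInverse.comp_apply_one
    (h : StablyInverse ρ (Representation.trivial k G k) F S)
    {E : X → V →ₗ[k] k} {T : X → k →ₗ[k] V}
    (hE : IsEquivariant ρ (Representation.trivial k G k) E)
    (hT : IsEquivariant (Representation.trivial k G k) ρ T)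
    (x : X) (hx : p ∣ Nat.card (MulAction.stabilizer G x)) :
    E x (S x 1) * F x (T x 1) = E x (T x 1) := by
  -- Modulo traces `E S F T = E T`. Both sides are scalars, so they agree where `p` divides the
  -- stabilizer.
  have h1 := (h.right_left.comp_sub_right hT).comp_sub_left hE
  have h2 := (isTrace_sub_iff p (hE.comp ((h.right.comp h.left).comp hT))
    (hE.comp hT)).mp h1 x hx
  refine Eq.trans ?_ h2
  change _ = E x (S x (F x (T x 1)))
  have h3 : ∀ c : k, S x c = c • S x 1 := fun c => by rw [← map_smul, smul_eq_mul, mul_one]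
  rw [h3 (F x _), map_smul, smul_eq_mul, mul_comm]

theorem StablyInverse.apply_apply_one
    (h : StablyInverse ρ (Representation.trivial k G k) F S) (x : X)
    (hx : p ∣ Nat.card (MulAction.stabilizer G x)) : F x (S x 1) = 1 :=
  (isTrace_sub_iff p (h.left.comp h.right) IsEquivariant.id).mp h.left_right x hx

/-- Modulo traces, `F x = F x S y F y = F y`. The conclusion is the descent hypothesis of
`StablyInverse.descend`. -/
theorem StablyInverse.isTrace_of_transition_eq_one
    (h : StablyInverse ρ (Representation.trivial k G k) F S)
    (h1 : ∀ x : X × X, p ∣ Nat.card (MulAction.stabilizer G x) → F x.1 (S x.2 1) = 1) :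
    IsTrace ρ (Representation.trivial k G k) (fun x : X × X => F x.1 - F x.2) := by
  have e1 := h.pull (Prod.fst : X × X → X) fun _ _ => rfl
  have e2 := h.pull (Prod.snd : X × X → X) fun _ _ => rfl
  have h2 := (isTrace_sub_iff p (e1.left.comp e2.right) IsEquivariant.id).mpr h1
  have h3 := h2.comp_sub_right e2.left
  exact ((e2.right_left.comp_sub_left e1.left).sub_comm).sub_trans h3

end Trivial

end StableInverse

/-! ### Lifting idempotents and splitting them -/

section Idempotents

open Polynomial in
/-- A polynomial that lifts idempotents modulo an ideal containing `a * a - a`. -/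
theorem exists_idempotent_polynomial {k A : Type*} [Field k] [Ring A] [Algebra k A] {a : A}
    (ha : IsIntegral k a) :
    ∃ e q : k[X], IsIdempotentElem (aeval a e) ∧ e - X = q * (X * X - X) := by
  have hX1 : (X - C 1 : k[X]) ≠ 0 := X_sub_C_ne_zero 1
  -- The extra factors force `1` to be a root, so `t ≠ 0`, and `X` to divide the cofactor `r` of `(X
  -- - 1) ^ t`.
  set f : k[X] := minpoly k a * X * (X - C 1) with hf
  have hf0 : f ≠ 0 := mul_ne_zero (mul_ne_zero (minpoly.ne_zero ha) X_ne_zero) hX1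
  obtain ⟨r, hr, hnd⟩ := exists_eq_pow_rootMultiplicity_mul_and_not_dvd f hf0 1
  set t := rootMultiplicity 1 f
  have ht : t ≠ 0 := by
    intro ht
    rw [ht, pow_zero, one_mul] at hr
    exact hnd (hr ▸ Dvd.intro_left _ rfl)
  have hc : IsCoprime ((X - C 1 : k[X]) ^ t) r :=
    ((irreducible_X_sub_C (1 : k)).coprime_iff_not_dvd.mpr hnd).pow_left
  have hcX : IsCoprime (X : k[X]) (X - C 1) := ⟨1, -1, by simp⟩
  have hXr : (X : k[X]) ∣ r := by
    have h1 : (X : k[X]) ∣ (X - C 1) ^ t * r := by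
      rw [← hr]
      exact Dvd.intro_left (minpoly k a * (X - C 1)) (by rw [hf]; ring)
    exact (hcX.pow_right (n := t)).dvd_of_dvd_mul_left h1
  -- Chinese remainder theorem: `e = β * r` is `1` modulo `(X - 1) ^ t` and `0` modulo `r`. So `e`
  -- agrees with `X` modulo `X` and modulo `X - 1`, while `e - e * e` is a multiple of `f` and hence
  -- of the minimal polynomial.
  obtain ⟨α, β, hαβ⟩ := hc
  have hdvd : (X * (X - C 1) : k[X]) ∣ β * r - X := by
    refine hcX.mul_dvd (dvd_sub (hXr.mul_left β) dvd_rfl) ?_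
    have h1 : β * r - X = - (α * (X - C 1) ^ t) - (X - C 1) := by
      rw [C_1]
      rw [C_1] at hαβ
      linear_combination hαβ
    rw [h1]
    exact dvd_sub ((dvd_neg).mpr ((dvd_pow_self _ ht).mul_left α)) dvd_rfl
  obtain ⟨q, hq⟩ := hdvd
  refine ⟨β * r, q, ?_, by rw [hq, C_1]; ring⟩
  have h2 : β * r - β * r * (β * r) = α * β * (X * (X - C 1)) * minpoly k a := by
    have : α * β * (X * (X - C 1)) * minpoly k a = α * β * f := by rw [hf]; ring
    rw [this, hr]
    linear_combination (β * r) * (- hαβ)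
  have h3 := congrArg (aeval a) h2
  rw [map_sub, map_mul (aeval a) (β * r) (β * r), map_mul _ _ (minpoly k a), minpoly.aeval,
    mul_zero, sub_eq_zero] at h3
  exact h3.symm

end Idempotents

section Retract

variable {k : Type*} [Field k] {G : Type*} [Group G]
variable {V W : Type*} [AddCommGroup V] [Module k V] [AddCommGroup W] [Module k W]

/-- The image is transported to `k ^ d` so that it lies in the universe of `k`, as `FDRep k G`
demands; functions on a `G`-set need not lie there. -/
theorem exists_retract [FiniteDimensional k V] (b : V →ₗ[k] V) (hb : b ∘ₗ b = b) :
    ∃ (d : ℕ) (i : (Fin d → k) →ₗ[k] V) (π : V →ₗ[k] (Fin d → k)),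
      i ∘ₗ π = b ∧ π ∘ₗ i = LinearMap.id := by
  let φ := (Module.finBasis k (LinearMap.range b)).equivFun
  refine ⟨_, (LinearMap.range b).subtype ∘ₗ φ.symm.toLinearMap,
    φ.toLinearMap ∘ₗ b.rangeRestrict, LinearMap.ext fun f => by simp,
    LinearMap.ext fun w => φ.symm.injective (Subtype.ext ?_)⟩
  obtain ⟨v, hv⟩ := (φ.symm w).2
  simp only [LinearMap.comp_apply, LinearEquiv.coe_coe, LinearEquiv.symm_apply_apply,
    Submodule.subtype_apply, LinearMap.codRestrict_apply, LinearMap.id_apply]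
  rw [← hv]
  exact congrArg (fun t : V →ₗ[k] V => t v) hb

/-- The representation on the image of an equivariant idempotent. -/
def retractRep (ρ : Representation k G V) (i : W →ₗ[k] V) (π : V →ₗ[k] W)
    (hπi : π ∘ₗ i = LinearMap.id) (hc : ∀ g, (i ∘ₗ π) ∘ₗ ρ g = ρ g ∘ₗ (i ∘ₗ π)) :
    Representation k G W where
  toFun g := π ∘ₗ ρ g ∘ₗ i
  map_one' := by
    rw [map_one]
    exact hπi
  map_mul' g h := by
    have h1 : ∀ v, π (i v) = v := fun v => congrArg (fun t : W →ₗ[k] W => t v) hπi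
    have h2 : ∀ v, i (π (ρ h v)) = ρ h (i (π v)) :=
      fun v => congrArg (fun t : V →ₗ[k] V => t v) (hc h)
    ext w
    simp only [map_mul, LinearMap.comp_apply, Module.End.mul_apply]
    rw [h2, h1]

end Retract

/-! ### Effectivity of descent data -/

section Effective

variable {k : Type*} [Field k] {G : Type*} [Group G] {X Y : Type*} [MulAction G X] [MulAction G Y]

/-- The permutation representation on functions. -/
def funRep (k : Type*) [Field k] (G : Type*) [Group G] (X : Type*) [MulAction G X] :
    Representation k G (X → k) where
  toFun g := LinearMap.funLeft k k fun x => g⁻¹ • x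
  map_one' := by
    ext f x
    simp
  map_mul' g h := by
    ext f x
    simp [mul_smul, LinearMap.funLeft_apply]

theorem isEquivariant_proj :
    IsEquivariant (funRep k G X) (Representation.trivial k G k)
      (fun x : X => LinearMap.proj x) := fun g x => by
  ext f
  simp [funRep, LinearMap.funLeft_apply]

theorem isEquivariant_single [DecidableEq X] :
    IsEquivariant (Representation.trivial k G k) (funRep k G X)
      (fun x : X => LinearMap.single k (fun _ => k) x) := fun g x => by
  refine LinearMap.ext_ring (funext fun y => ?_)
  simp [funRep, LinearMap.funLeft_apply, Pi.single_apply, inv_smul_eq_iff]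

variable [Fintype G] [Fintype X]

/-- Descent data on the constant one-dimensional representation are effective. -/
theorem exists_stablyInverse_of_cocycle (p : ℕ) [CharP k p]
    (hX : (Fintype.card X : k) ≠ 0)
    (c : X → X → k) (hc : ∀ (g : G) x y, c (g • x) (g • y) = c x y)
    (hmul : ∀ x y z, p ∣ Nat.card (MulAction.stabilizer G (x, y, z)) → c x y * c y z = c x z)
    (hone : ∀ x, p ∣ Nat.card (MulAction.stabilizer G x) → c x x = 1) :
    ∃ (d : ℕ) (ρ : Representation k G (Fin d → k)) (F : X → (Fin d → k) →ₗ[k] k)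
      (S : X → k →ₗ[k] (Fin d → k)), StablyInverse ρ (Representation.trivial k G k) F S ∧
      ∀ x y, p ∣ Nat.card (MulAction.stabilizer G (x, y)) → F x (S y 1) = c x y := by
  classical
  let n : k := Fintype.card X
  -- `P x` is row `x` of the matrix `c`, `T x` is column `x` divided by `n`, and `a` is the matrix
  -- `c / n`. For a strict cocycle, `T x ∘ P x = a` and `P x ∘ T y = c x y` would hold exactly; here
  -- they hold modulo traces.
  let P : X → (X → k) →ₗ[k] k := fun x => ∑ y, c x y • LinearMap.proj y
  let T : X → k →ₗ[k] (X → k) := fun x => n⁻¹ • ∑ y, c y x • LinearMap.single k (fun _ => k) y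
  let a : (X → k) →ₗ[k] (X → k) := n⁻¹ • ∑ y : X × X, c y.1 y.2 •
    (LinearMap.single k (fun _ => k) y.1 ∘ₗ LinearMap.proj y.2)
  have eP : IsEquivariant (funRep k G X) (Representation.trivial k G k) P :=
    ((isEquivariant_proj.pull (Prod.snd : X × X → X) fun _ _ => rfl).smul
      (fun x : X × X => c x.1 x.2) fun g x => hc g x.1 x.2).sum_fiber
  have eT : IsEquivariant (Representation.trivial k G k) (funRep k G X) T :=
    ((isEquivariant_single.pull (Prod.snd : X × X → X) fun _ _ => rfl).smul
      (fun x : X × X => c x.2 x.1) fun g x => hc g x.2 x.1).sum_fiber.smul (fun _ => n⁻¹)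
      fun _ _ => rfl
  have eM : IsEquivariant (funRep k G X) (funRep k G X) (fun y : X × X =>
      LinearMap.single k (fun _ => k) y.1 ∘ₗ LinearMap.proj y.2) :=
    (isEquivariant_single.pull (Prod.fst : X × X → X) fun _ _ => rfl).comp
      (isEquivariant_proj.pull (Prod.snd : X × X → X) fun _ _ => rfl)
  have ea' : IsEquivariant (funRep k G X) (funRep k G X) (fun _ : PUnit.{1} => a) :=
    ((eM.smul (fun y : X × X => c y.1 y.2) fun g x => hc g x.1 x.2).pull
      (Prod.snd : PUnit.{1} × (X × X) → X × X) fun _ _ => rfl).sum_fiber.smul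
      (fun _ => n⁻¹) fun _ _ => rfl
  have ea : IsEquivariant (funRep k G X) (funRep k G X) (fun _ : X => a) :=
    fun g _ => ea' g PUnit.unit
  -- The `(y, z)` entry of the difference is `(c y x * c x z - c y z) / n`. The scalar `c y x * c x
  -- z - c y z` vanishes wherever `p` divides the stabilizer of `(x, y, z)`, so over `X × (X × X)`
  -- it produces a trace, which is then summed over `(y, z)`.
  have hTP : IsTrace (funRep k G X) (funRep k G X) (fun x => T x ∘ₗ P x - a) := by
    have h1 := ((eM.pull (Prod.snd : X × (X × X) → X × X) fun _ _ => rfl).isTrace_smul p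
      (fun x => c x.2.1 x.1 * c x.1 x.2.2 - c x.2.1 x.2.2)
      (fun g x => by
        change c (g • x.2.1) (g • x.1) * c (g • x.1) (g • x.2.2) -
          c (g • x.2.1) (g • x.2.2) = _
        rw [hc, hc, hc])
      (fun x hx => by
        rw [hmul, sub_self]
        convert hx using 3
        ext g
        simp [MulAction.mem_stabilizer_iff, Prod.ext_iff, and_left_comm])).sum_fiber.const_smul n⁻¹
    convert h1 using 2 with x
    ext y z
    simp [T, P, a, Fintype.sum_prod_type, sub_smul, Finset.sum_apply, Pi.single_apply,
      Finset.sum_sub_distrib, mul_sub]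
  have hPT : IsTrace (Representation.trivial k G k) (Representation.trivial k G k)
      (fun x : X × X => P x.1 ∘ₗ T x.2 - c x.1 x.2 • LinearMap.id) := by
    have h1 := ((IsEquivariant.id (X := (X × X) × X)
      (ρ := Representation.trivial k G k)).isTrace_smul p
      (fun x => c x.1.1 x.2 * c x.2 x.1.2 - c x.1.1 x.1.2)
      (fun g x => by
        change c (g • x.1.1) (g • x.2) * c (g • x.2) (g • x.1.2) -
          c (g • x.1.1) (g • x.1.2) = _
        rw [hc, hc, hc])
      (fun x hx => by
        rw [hmul, sub_self]
        convert hx using 3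
        ext g
        simp [MulAction.mem_stabilizer_iff, Prod.ext_iff, and_left_comm, and_comm])).sum_fiber.const_smul
          n⁻¹
    convert h1 using 2 with x
    refine LinearMap.ext_ring ?_
    have : n * (n⁻¹ * c x.1 x.2) = c x.1 x.2 := by
      rw [← mul_assoc, mul_inv_cancel₀ hX, one_mul]
    simp [T, P, sub_smul, Finset.sum_apply, Pi.single_apply, Finset.sum_sub_distrib, mul_sub,
      Finset.mul_sum, mul_left_comm]
    exact this.symm
  have hdiag : IsTrace (Representation.trivial k G k) (Representation.trivial k G k)
      (fun x : X => P x ∘ₗ T x - LinearMap.id) := by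
    refine (hPT.pull (fun x : X => (x, x)) fun _ _ => rfl).sub_trans ?_
    have h1 := (IsEquivariant.id (X := X) (ρ := Representation.trivial k G k)).isTrace_smul p
      (fun x => c x x - 1) (fun g x => by rw [hc]) fun x hx => by rw [hone x hx, sub_self]
    convert h1 using 2
    exact LinearMap.ext_ring (by simp)
  -- Modulo traces, `a a = T P T P = T P = a`, since `P x ∘ T x` is stably the identity.
  have haa : IsTrace (funRep k G X) (funRep k G X) (fun _ : X => a ∘ₗ a - a) := by
    have h1 := (hTP.comp_sub_comp hTP ea (eT.comp eP)).sub_comm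
    have h2 := (hdiag.comp_sub_right eP).comp_sub_left eT
    exact (h1.sub_trans h2).sub_trans hTP
  obtain ⟨e, q, he, heq⟩ := exists_idempotent_polynomial (k := k) (a := (a : Module.End k (X → k)))
    (Algebra.IsIntegral.isIntegral _)
  have epoly : ∀ (f : Polynomial k) (g : G), Polynomial.aeval (a : Module.End k (X → k)) f ∘ₗ
      funRep k G X g = funRep k G X g ∘ₗ Polynomial.aeval (a : Module.End k (X → k)) f := by
    intro f g
    have h1 : Commute (a : Module.End k (X → k)) (funRep k G X g) :=
      ea' g PUnit.unit
    induction f using Polynomial.induction_on' with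
    | add f f' h h' => rw [map_add, LinearMap.add_comp, LinearMap.comp_add, h, h']
    | monomial m r =>
      rw [Polynomial.aeval_monomial]
      exact (Algebra.commute_algebraMap_left r _).mul_left (h1.pow_left m)
  let b : (X → k) →ₗ[k] (X → k) := Polynomial.aeval (a : Module.End k (X → k)) e
  have hbb : b ∘ₗ b = b := he
  -- `b - a` is the product of the equivariant map `q(a)` and the trace `a a - a`.
  have hba : IsTrace (funRep k G X) (funRep k G X) (fun _ : X => b - a) := by
    have h1 := haa.comp_left (E := fun _ => Polynomial.aeval (a : Module.End k (X → k)) q)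
      (τ := funRep k G X) fun g _ => epoly q g
    have h2 := congrArg (Polynomial.aeval (a : Module.End k (X → k))) heq
    simp only [map_sub, map_mul, Polynomial.aeval_X] at h2
    have h3 : b - a = Polynomial.aeval (a : Module.End k (X → k)) q ∘ₗ (a ∘ₗ a - a) := h2
    rwa [h3]
  obtain ⟨d, i, π, hi, hπ⟩ := exists_retract b hbb
  have hcomm : ∀ g, (i ∘ₗ π) ∘ₗ funRep k G X g = funRep k G X g ∘ₗ (i ∘ₗ π) := by
    rw [hi]
    exact epoly e
  have ei : IsEquivariant (retractRep (funRep k G X) i π hπ hcomm) (funRep k G X)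
      (fun _ : X => i) := fun g _ => by
    change i ∘ₗ (π ∘ₗ funRep k G X g ∘ₗ i) = _
    rw [← LinearMap.comp_assoc, ← LinearMap.comp_assoc, hcomm, LinearMap.comp_assoc,
      LinearMap.comp_assoc, hπ, LinearMap.comp_id]
  have eπ : IsEquivariant (funRep k G X) (retractRep (funRep k G X) i π hπ hcomm)
      (fun _ : X => π) := fun g _ => by
    change _ = (π ∘ₗ funRep k G X g ∘ₗ i) ∘ₗ π
    rw [LinearMap.comp_assoc, LinearMap.comp_assoc, ← hcomm, LinearMap.comp_assoc,
      ← LinearMap.comp_assoc, hπ, LinearMap.id_comp]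
  have hbTP : IsTrace (funRep k G X) (funRep k G X) (fun x => b - T x ∘ₗ P x) :=
    hba.sub_trans hTP.sub_comm
  -- Since `b = i ∘ π` is congruent to `T x ∘ P x`, restricting `P` to the image of `b` and
  -- projecting `T` onto it makes them stably inverse; they still compose to `c`.
  refine ⟨_, retractRep (funRep k G X) i π hπ hcomm, fun x => P x ∘ₗ i, fun x => π ∘ₗ T x,
    ⟨eP.comp ei, eπ.comp eT, ?_, ?_⟩, ?_⟩
  · have h1 := (hbTP.sub_comm.comp_sub_right ei).comp_sub_left eπ
    have h2 : π ∘ₗ b ∘ₗ i = LinearMap.id := by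
      rw [← hi, LinearMap.comp_assoc, hπ, LinearMap.comp_id, hπ]
    rwa [h2] at h1
  · have h1 := (hbTP.comp_sub_right eT).comp_sub_left eP
    have h2 := hdiag.comp_sub_left (eP.comp eT)
    rw [← hi] at h1
    exact (h1.sub_trans h2).sub_trans hdiag
  · have eP1 := eP.pull (Prod.fst : X × X → X) fun _ _ => rfl
    have eT2 := eT.pull (Prod.snd : X × X → X) fun _ _ => rfl
    have h1 := ((hbTP.pull (Prod.snd : X × X → X) fun _ _ => rfl).comp_sub_right
      eT2).comp_sub_left eP1
    have h2 := (hdiag.pull (Prod.snd : X × X → X) fun _ _ => rfl).comp_sub_left (eP1.comp eT2)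
    rw [← hi] at h1
    have h3 := (h1.sub_trans h2).sub_trans hPT
    intro x y hxy
    have h4 := (isTrace_sub_iff p ((eP1.comp (ei.pull Prod.fst fun _ _ => rfl)).comp
      ((eπ.pull Prod.fst fun _ _ => rfl).comp eT2))
      (IsEquivariant.id.smul (fun x : X × X => c x.1 x.2) fun g x => hc g x.1 x.2)).mp h3 (x, y) hxy
    simpa using h4

end Effective

/-! ### Families over `G/H` and `H`-equivariant maps -/

section Induction
variable {k : Type*} [Field k] {G : Type*} [Group G] {H : Subgroup G}
variable {V W Z : Type*} [AddCommGroup V] [Module k V] [AddCommGroup W] [Module k W]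
  [AddCommGroup Z] [Module k Z]
variable {ρ : Representation k G V} {σ : Representation k G W} {τ : Representation k G Z}

/-- The family over `G ⧸ H` obtained by conjugating an `H`-equivariant map. -/
noncomputable def inducedFamily (ρ : Representation k G V) (σ : Representation k G W)
    (F : V →ₗ[k] W) (q : G ⧸ H) : V →ₗ[k] W :=
  σ q.out ∘ₗ F ∘ₗ ρ q.out⁻¹

/-- `H`-equivariance makes the conjugate independent of the representative of the coset. -/
theorem inducedFamily_mk {F : V →ₗ[k] W}
    (hF : IsEquivariant (ρ.comp H.subtype) (σ.comp H.subtype) (fun _ : PUnit.{1} => F)) (g : G) :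
    inducedFamily ρ σ F (g : G ⧸ H) = σ g ∘ₗ F ∘ₗ ρ g⁻¹ := by
  obtain ⟨h, hh⟩ := QuotientGroup.mk_out_eq_mul H g
  have h1 : σ (h : G) ∘ₗ F ∘ₗ ρ (h : G)⁻¹ = F := (hF.apply_smul h PUnit.unit).symm
  rw [inducedFamily, hh, mul_inv_rev, map_mul, map_mul]
  nth_rw 2 [← h1]
  rfl

theorem IsEquivariant.inducedFamily {F : V →ₗ[k] W}
    (hF : IsEquivariant (ρ.comp H.subtype) (σ.comp H.subtype) (fun _ : PUnit.{1} => F)) :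
    IsEquivariant ρ σ (inducedFamily (H := H) ρ σ F) := fun g x => by
  induction x using QuotientGroup.induction_on with | H x => ?_
  change SippCech.inducedFamily ρ σ F ((g * x : G) : G ⧸ H) ∘ₗ _ = _
  rw [inducedFamily_mk hF, inducedFamily_mk hF, mul_inv_rev, map_mul, map_mul]
  ext v
  simp [← Module.End.mul_apply, ← map_mul]

theorem inducedFamily_comp (F : V →ₗ[k] W) (E : W →ₗ[k] Z) (q : G ⧸ H) :
    inducedFamily σ τ E q ∘ₗ inducedFamily ρ σ F q = inducedFamily ρ τ (E ∘ₗ F) q := by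
  ext v
  simp [inducedFamily]

theorem inducedFamily_sub_id (F : V →ₗ[k] V) (q : G ⧸ H) :
    inducedFamily ρ ρ (F - LinearMap.id) q = inducedFamily ρ ρ F q - LinearMap.id := by
  ext v
  simp [inducedFamily]

theorem IsEquivariant.restrict {F : G ⧸ H → V →ₗ[k] W} (hF : IsEquivariant ρ σ F) :
    IsEquivariant (ρ.comp H.subtype) (σ.comp H.subtype)
      (fun _ : PUnit.{1} => F ((1 : G) : G ⧸ H)) := fun h _ => by
  have h1 := hF h ((1 : G) : G ⧸ H)
  have h2 : (h : G) • ((1 : G) : G ⧸ H) = ((1 : G) : G ⧸ H) := by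
    change ((h * 1 : G) : G ⧸ H) = _
    rw [mul_one, QuotientGroup.eq]
    simp
  rwa [h2] at h1

variable [Fintype G] [Fintype H]

theorem IsTrace.inducedFamily {F : V →ₗ[k] W}
    (hF : IsTrace (ρ.comp H.subtype) (σ.comp H.subtype) (fun _ : PUnit.{1} => F)) :
    IsTrace ρ σ (inducedFamily (H := H) ρ σ F) := by
  classical
  obtain ⟨θ, hθ⟩ := hF
  replace hθ : F = ∑ h : H, σ (h : G) ∘ₗ θ PUnit.unit ∘ₗ ρ (h : G)⁻¹ := hθ PUnit.unit
  -- With `θ` supported at the base coset, only the `g` in the coset `q` contribute, and their sum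
  -- is the conjugate of the trace over `H`.
  refine ⟨fun q => if q = ((1 : G) : G ⧸ H) then θ PUnit.unit else 0, fun q => ?_⟩
  let x := q.out
  have hx : (x : G ⧸ H) = q := QuotientGroup.out_eq' q
  rw [SippCech.inducedFamily, hθ, fintype_sum_comp, comp_fintype_sum,
    ← Equiv.sum_comp (Equiv.mulLeft x)]
  have h1 : ∀ g : G, (if ((Equiv.mulLeft x) g)⁻¹ • q = ((1 : G) : G ⧸ H) then θ PUnit.unit else 0) =
      if g ∈ H then θ PUnit.unit else 0 := fun g => by
    have : ((Equiv.mulLeft x) g)⁻¹ • q = ((g⁻¹ : G) : G ⧸ H) := by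
      rw [← hx]
      change (((x * g)⁻¹ * x : G) : G ⧸ H) = _
      rw [mul_inv_rev, inv_mul_cancel_right]
    simp only [this, QuotientGroup.eq, inv_inv, mul_one]
  simp only [h1]
  have h2 : ∀ g : G, σ ((Equiv.mulLeft x) g) ∘ₗ (if g ∈ H then θ PUnit.unit else 0) ∘ₗ
      ρ ((Equiv.mulLeft x) g)⁻¹ = if g ∈ H then σ x ∘ₗ (σ g ∘ₗ θ PUnit.unit ∘ₗ ρ g⁻¹) ∘ₗ ρ x⁻¹
        else 0 := fun g => by
    split_ifs
    · rw [Equiv.coe_mulLeft, mul_inv_rev, map_mul, map_mul]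
      rfl
    · simp
  simp only [h2]
  rw [← Finset.sum_filter, Finset.sum_subtype (p := fun g => g ∈ H) _ (by simp)]

theorem IsTrace.restrict {F : G ⧸ H → V →ₗ[k] W} (hF : IsTrace ρ σ F) :
    IsTrace (ρ.comp H.subtype) (σ.comp H.subtype)
      (fun _ : PUnit.{1} => F ((1 : G) : G ⧸ H)) := by
  classical
  obtain ⟨θ, hθ⟩ := hF
  -- Writing each element of `G` as `h * q.out⁻¹` splits the trace over `G` at the base coset into a
  -- sum over cosets, which is the new `θ`, followed by the trace over `H`.
  refine ⟨fun _ => ∑ q : G ⧸ H, σ q.out⁻¹ ∘ₗ θ q ∘ₗ ρ q.out, fun _ => ?_⟩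
  beta_reduce
  rw [hθ, ← Equiv.sum_comp (Equiv.inv G), ← Equiv.sum_comp (quotientProdEquiv H),
    Fintype.sum_prod_type_right, ← Equiv.sum_comp (Equiv.inv H)]
  refine Finset.sum_congr rfl fun h _ => ?_
  rw [fintype_sum_comp, comp_fintype_sum]
  refine Finset.sum_congr rfl fun q _ => ?_
  have h1 : (q.out * (h⁻¹ : H) : G) • ((1 : G) : G ⧸ H) = q := by
    change ((q.out * (h⁻¹ : H) * 1 : G) : G ⧸ H) = q
    rw [mul_one, QuotientGroup.mk_mul_of_mem _ (h⁻¹).2, QuotientGroup.out_eq']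
  simp only [Equiv.inv_apply, quotientProdEquiv_apply, inv_inv, h1, mul_inv_rev, map_mul]
  ext v
  simp

theorem StablyInverse.inducedFamily {F : V →ₗ[k] W} {S : W →ₗ[k] V}
    (h : StablyInverse (ρ.comp H.subtype) (σ.comp H.subtype) (fun _ : PUnit.{1} => F)
      (fun _ => S)) :
    StablyInverse ρ σ (inducedFamily (H := H) ρ σ F) (inducedFamily (H := H) σ ρ S) where
  left := h.left.inducedFamily
  right := h.right.inducedFamily
  right_left := by
    simpa only [inducedFamily_comp, ← inducedFamily_sub_id] using! h.right_left.inducedFamily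
  left_right := by
    simpa only [inducedFamily_comp, ← inducedFamily_sub_id] using! h.left_right.inducedFamily

theorem StablyInverse.restrict {F : G ⧸ H → V →ₗ[k] W} {S : G ⧸ H → W →ₗ[k] V}
    (h : StablyInverse ρ σ F S) :
    StablyInverse (ρ.comp H.subtype) (σ.comp H.subtype)
      (fun _ : PUnit.{1} => F ((1 : G) : G ⧸ H)) (fun _ => S ((1 : G) : G ⧸ H)) :=
  ⟨h.left.restrict, h.right.restrict, h.right_left.restrict, h.left_right.restrict⟩

end Induction

/-! ### Higman's criterion for representations of finite groupoids -/

section StableCategory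

/-- Transitivity uses the biproduct of the two projectives. Since the relation is a congruence,
equality in `Stab C` is the relation itself and not merely what it generates. -/
instance congruence_stableRel {C : Type*} [Category* C] [Preadditive C] [HasBinaryBiproducts C]
    [HasZeroObject C] :
    Congruence (stableRel C) where
  comp_left f g g' h := by
    obtain ⟨P, hP, a, b, hab⟩ := h
    exact ⟨P, hP, f ≫ a, b, by rw [← Preadditive.comp_sub, hab, Category.assoc]⟩
  comp_right g h := by
    obtain ⟨P, hP, a, b, hab⟩ := h
    exact ⟨P, hP, a, b ≫ g, by rw [← Preadditive.sub_comp, hab, Category.assoc]⟩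
  equivalence :=
    { refl f := ⟨_, Projective.zero_projective, 0, 0, by simp⟩
      symm h := by
        obtain ⟨P, hP, a, b, hab⟩ := h
        exact ⟨P, hP, -a, b, by rw [← neg_sub, hab, Preadditive.neg_comp]⟩
      trans h h' := by
        obtain ⟨P, hP, a, b, hab⟩ := h
        obtain ⟨P', hP', a', b', hab'⟩ := h'
        exact ⟨P ⊞ P', inferInstance, biprod.lift a a', biprod.desc b b', by
          rw [biprod.lift_desc, ← hab, ← hab', sub_add_sub_cancel]⟩ }

theorem toStab_map_eq_iff {C : Type*} [Category* C] [Preadditive C] [HasBinaryBiproducts C]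
    [HasZeroObject C]
    {X Y : C} (f g : X ⟶ Y) : (toStab C).map f = (toStab C).map g ↔ stableRel C f g :=
  CategoryTheory.Quotient.functor_map_eq_iff _ _ _

theorem stableRel_equivalence_iff {C D : Type*} [Category* C] [Category* D] [Preadditive C]
    [Preadditive D] (E : C ≌ D) [E.functor.Additive] {X Y : C} (f g : X ⟶ Y) :
    stableRel D (E.functor.map f) (E.functor.map g) ↔ stableRel C f g := by
  constructor
  · rintro ⟨P, hP, a, b, hab⟩
    have : Projective (E.inverse.obj P) := E.symm.map_projective_iff P |>.mpr hP
    refine ⟨E.inverse.obj P, this, E.unit.app X ≫ E.inverse.map a,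
      E.inverse.map b ≫ E.unitInv.app Y, ?_⟩
    rw [Category.assoc, ← E.inverse.map_comp_assoc, ← hab, ← E.functor.map_sub]
    simp
  · rintro ⟨P, hP, a, b, hab⟩
    exact ⟨E.functor.obj P, (E.map_projective_iff P).mpr hP, E.functor.map a, E.functor.map b, by
      rw [← E.functor.map_sub, hab, E.functor.map_comp]⟩

variable {J A : Type*} [Category* J] [IsGroupoid J] [Category* A] [Preadditive A]
  [∀ x : J, Finite (Σ y : J, y ⟶ x)]

/-- A natural transformation of representations of a groupoid that is a trace. -/
def IsTraceMap {P Q : J ⥤ A} (f : P ⟶ Q) : Prop :=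
  ∃ θ : ∀ x, P.obj x ⟶ Q.obj x, ∀ x,
    letI := Fintype.ofFinite (Σ y : J, y ⟶ x)
    f.app x = ∑ a : (Σ y : J, y ⟶ x), P.map (inv a.2) ≫ θ a.1 ≫ Q.map a.2

theorem freeMap_inv_comp_π [HasFiniteBiproducts A] (P : J ⥤ A) {y x : J} (f : y ⟶ x) :
    freeMap P (inv f) ≫ biproduct.π (fun a : (Σ z : J, z ⟶ y) => P.obj a.1) ⟨y, 𝟙 y⟩ =
      biproduct.π (fun a : (Σ z : J, z ⟶ x) => P.obj a.1) ⟨y, f⟩ := by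
  classical
  refine freeObj_hom_ext P fun z g => ?_
  rw [← Category.assoc, freeι_map]
  by_cases hzy : (⟨z, g⟩ : Σ y : J, y ⟶ x) = ⟨y, f⟩
  · cases hzy
    rw [IsIso.hom_inv_id]
    exact (biproduct.ι_π_self (fun a : (Σ z : J, z ⟶ y) => P.obj a.1) ⟨y, 𝟙 y⟩).trans
      (biproduct.ι_π_self (fun a : (Σ z : J, z ⟶ x) => P.obj a.1) ⟨y, f⟩).symm
  · have : (⟨z, g ≫ inv f⟩ : Σ z : J, z ⟶ y) ≠ ⟨y, 𝟙 y⟩ := by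
      intro h
      apply hzy
      obtain ⟨rfl, h2⟩ := Sigma.mk.inj_iff.mp h
      have h3 : g ≫ inv f = 𝟙 _ := eq_of_heq h2
      have : g = f := by simpa using congrArg (· ≫ f) h3
      rw [this]
    exact (biproduct.ι_π_ne (fun a : (Σ z : J, z ⟶ y) => P.obj a.1) this).trans
      (biproduct.ι_π_ne (fun a : (Σ z : J, z ⟶ x) => P.obj a.1) hzy).symm

theorem freeObj_total [HasFiniteBiproducts A] (P : J ⥤ A) (x : J)
    [Fintype (Σ y : J, y ⟶ x)] :
    ∑ a : (Σ y : J, y ⟶ x), biproduct.π (fun a : (Σ y : J, y ⟶ x) => P.obj a.1) a ≫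
      biproduct.ι (fun a : (Σ y : J, y ⟶ x) => P.obj a.1) a = 𝟙 (freeObj P x) := by
  classical
  refine freeObj_hom_ext P fun y f => ?_
  rw [Preadditive.comp_sum, Finset.sum_eq_single ⟨y, f⟩]
  · rw [freeι, biproduct.ι_π_self_assoc]
    exact (Category.comp_id _).symm
  · intro b _ hb
    rw [freeι, biproduct.ι_π_ne_assoc _ hb.symm, zero_comp]
  · exact fun h => (h (Finset.mem_univ _)).elim

/-- The identity is the trace of the projection onto the summand of the identity arrow: the
conjugates of this projection are the projections onto the other summands. -/
theorem projective_freeCover [HasFiniteBiproducts A] [HasPushouts A]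
    (hA : ∀ V : A, Projective V) (P : J ⥤ A) : Projective (freeCover P) := by
  classical
  refine projective_of_isTraceSplit hA _ ⟨fun x =>
    biproduct.π (fun a : (Σ y : J, y ⟶ x) => P.obj a.1) ⟨x, 𝟙 x⟩ ≫ freeι P (𝟙 x), fun x => ?_⟩
  let _ := Fintype.ofFinite (Σ y : J, y ⟶ x)
  have h : ∀ a : (Σ y : J, y ⟶ x), (freeCover P).map (inv a.2) ≫
      (biproduct.π (fun b : (Σ y : J, y ⟶ a.1) => P.obj b.1) ⟨a.1, 𝟙 a.1⟩ ≫ freeι P (𝟙 a.1)) ≫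
        (freeCover P).map a.2 =
      biproduct.π (fun a : (Σ y : J, y ⟶ x) => P.obj a.1) a ≫
        biproduct.ι (fun a : (Σ y : J, y ⟶ x) => P.obj a.1) a := by
    rintro ⟨y, f⟩
    change freeMap P (inv f) ≫ (biproduct.π (fun b : (Σ z : J, z ⟶ y) => P.obj b.1) ⟨y, 𝟙 y⟩ ≫
      freeι P (𝟙 y)) ≫ freeMap P f = _
    rw [Category.assoc, freeι_map, ← Category.assoc, freeMap_inv_comp_π, Category.id_comp]
    rfl
  refine (Finset.sum_congr rfl fun a _ => h a).trans ?_
  exact freeObj_total P x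

/-- The map to the free representation that is dual to the action of arrows. -/
noncomputable def toFreeObj [HasFiniteBiproducts A] (P : J ⥤ A) (x : J) :
    P.obj x ⟶ freeObj P x :=
  letI := Fintype.ofFinite (Σ y : J, y ⟶ x)
  ∑ a : (Σ y : J, y ⟶ x), P.map (inv a.2) ≫ freeι P a.2

theorem map_comp_toFreeObj [HasFiniteBiproducts A] (P : J ⥤ A) {x x' : J} (h : x ⟶ x') :
    P.map h ≫ toFreeObj P x' = toFreeObj P x ≫ freeMap P h := by
  let _ : ∀ x : J, Fintype (Σ y : J, y ⟶ x) := fun x => Fintype.ofFinite _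
  let q : (Σ y : J, y ⟶ x) ≃ (Σ y : J, y ⟶ x') :=
    { toFun := fun a => ⟨a.1, a.2 ≫ h⟩
      invFun := fun a => ⟨a.1, a.2 ≫ inv h⟩
      left_inv := fun a => by simp
      right_inv := fun a => by simp }
  rw [toFreeObj, toFreeObj, ← q.sum_comp, Preadditive.comp_sum, Preadditive.sum_comp]
  refine Finset.sum_congr rfl fun a _ => ?_
  rw [Category.assoc, freeι_map]
  simp [q]

/-- If `f - g` factors through a projective `R`, the identity of `R` is a trace and naturality
carries this to `f - g`. Conversely, the trace of `θ` factors through the free representation: the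
dual `toFreeObj` of the action, followed by the map induced by `θ`. -/
theorem stableRel_iff_isTraceMap [HasFiniteBiproducts A] [HasPushouts A]
    (hA : ∀ V : A, Projective V) {P Q : J ⥤ A} (f g : P ⟶ Q) :
    stableRel (J ⥤ A) f g ↔ IsTraceMap (f - g) := by
  classical
  let _ : ∀ x : J, Fintype (Σ y : J, y ⟶ x) := fun x => Fintype.ofFinite _
  constructor
  · rintro ⟨R, hR, a, b, hab⟩
    obtain ⟨θ, hθ⟩ := isTraceSplit_of_projective R
    refine ⟨fun x => a.app x ≫ θ x ≫ b.app x, fun x => ?_⟩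
    have h1 : ∀ c : (Σ y : J, y ⟶ x), P.map (inv c.2) ≫ (a.app c.1 ≫ θ c.1 ≫ b.app c.1) ≫
        Q.map c.2 = a.app x ≫ (R.map (inv c.2) ≫ θ c.1 ≫ R.map c.2) ≫ b.app x := fun c => by
      simp
    rw [Finset.sum_congr rfl fun c _ => h1 c, ← Preadditive.comp_sum, ← Preadditive.sum_comp, hab]
    rw [hθ x, Category.id_comp, NatTrans.comp_app]
  · rintro ⟨θ, hθ⟩
    let s : P ⟶ freeCover P :=
      { app := fun x => toFreeObj P x
        naturality := fun x x' h => map_comp_toFreeObj P h }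
    let d : freeCover P ⟶ Q :=
      { app := fun x => biproduct.desc fun a : (Σ y : J, y ⟶ x) => θ a.1 ≫ Q.map a.2
        naturality := fun x x' h => freeObj_hom_ext P fun y f => by
          change freeι P f ≫ freeMap P h ≫
              (biproduct.desc fun a : (Σ y : J, y ⟶ x') => θ a.1 ≫ Q.map a.2) =
            freeι P f ≫ (biproduct.desc fun a : (Σ y : J, y ⟶ x) => θ a.1 ≫ Q.map a.2) ≫ Q.map h
          rw [← Category.assoc, freeι_map, ← Category.assoc]
          refine (biproduct.ι_desc _ _).trans ?_
          rw [freeι, biproduct.ι_desc]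
          simp }
    refine ⟨freeCover P, projective_freeCover hA P, s, d, ?_⟩
    ext x
    rw [hθ x, NatTrans.comp_app]
    change _ = (∑ a : (Σ y : J, y ⟶ x), P.map (inv a.2) ≫ freeι P a.2) ≫
      biproduct.desc fun a : (Σ y : J, y ⟶ x) => θ a.1 ≫ Q.map a.2
    rw [Preadditive.sum_comp]
    refine Finset.sum_congr rfl fun a _ => ?_
    rw [Category.assoc, freeι, biproduct.ι_desc]

end StableCategory

/-! ### Stable morphisms as families modulo traces -/

section Reps

variable {k : Type u} [Field k] {G : Type v} [Group G]

/-- The representation of the `G`-set `X` defined by a representation of `G`. -/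
def repConst {V : Type u} [AddCommGroup V] [Module k V] (ρ : Representation k G V) (X : GSet G) :
    GRep k X where
  obj _ := ModuleCat.of k V
  map g := ModuleCat.ofHom (ρ g.1)
  map_id x := by
    change ModuleCat.ofHom (ρ 1) = _
    rw [map_one]
    rfl
  map_comp f g := by
    change ModuleCat.ofHom (ρ (g.1 * f.1)) = _
    rw [map_mul]
    rfl

end Reps

section Bridge

variable {k : Type u} [Field k] {G : Type v} [Group G]

section GRep

theorem actionCategory_inv_val [Finite G] {X : GSet G} {x y : ActionCategory G X.V} (f : x ⟶ y) :
    (inv f).1 = f.1⁻¹ := by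
  have h := congrArg Subtype.val (IsIso.hom_inv_id f)
  exact eq_inv_of_mul_eq_one_left h

theorem mk_eq_of_eq {X : GSet G} {x y z : ActionCategory G X.V} (h : y = z) (g : G)
    (hy : g • y.back = x.back) (hz : g • z.back = x.back) :
    (⟨y, ⟨g, hy⟩⟩ : Σ y : ActionCategory G X.V, y ⟶ x) = ⟨z, ⟨g, hz⟩⟩ := by
  subst h
  rfl

variable {X : GSet G} {V W Z : Type u} [AddCommGroup V] [Module k V] [AddCommGroup W] [Module k W]
  [AddCommGroup Z] [Module k Z]
  {ρ : Representation k G V} {σ : Representation k G W} {τ : Representation k G Z}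

/-- The morphism of representations of `X` defined by an equivariant family. -/
def famHom (F : X.V → V →ₗ[k] W) (hF : IsEquivariant ρ σ F) :
    repConst ρ X ⟶ repConst σ X where
  app x := ModuleCat.ofHom (F x.back)
  naturality x y g := by
    have h := hF g.1 x.back
    rw [show g.1 • x.back = y.back from g.2] at h
    exact congrArg ModuleCat.ofHom h

/-- The equivariant family defined by a morphism of representations of `X`. -/
def homFam (f : repConst ρ X ⟶ repConst σ X) (x : X.V) : V →ₗ[k] W :=
  (f.app (ActionCategory.objEquiv G X.V x)).hom

theorem isEquivariant_homFam (f : repConst ρ X ⟶ repConst σ X) :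
    IsEquivariant ρ σ (homFam f) := fun g x => by
  let a : ActionCategory.objEquiv G X.V x ⟶ ActionCategory.objEquiv G X.V (g • x) := ⟨g, rfl⟩
  exact congrArg ModuleCat.Hom.hom (f.naturality a)

variable [Fintype G]

/-- The arrows into `x` are `g : g⁻¹ • x ⟶ x`, one for each `g` in `G`, so the groupoid trace is a
sum over `G`. -/
theorem toStab_map_eq_iff_isTrace (f g : repConst ρ X ⟶ repConst σ X) :
    (toStab (GRep k X)).map f = (toStab (GRep k X)).map g ↔
      IsTrace ρ σ (fun x => homFam f x - homFam g x) := by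
  rw [toStab_map_eq_iff, stableRel_iff_isTraceMap fun _ => inferInstance]
  let e : ∀ x : ActionCategory G X.V, G ≃ (Σ y : ActionCategory G X.V, y ⟶ x) := fun x =>
    Equiv.ofBijective (fun g => ⟨ActionCategory.objEquiv G X.V (g⁻¹ • x.back),
        ⟨g, smul_inv_smul g x.back⟩⟩) <| by
      constructor
      · intro g h hgh
        have : ∀ a b : (Σ y : ActionCategory G X.V, y ⟶ x), a = b →
          (a.2.1 : G) = b.2.1 := fun a b hab => by rw [hab]
        exact this _ _ hgh
      · rintro ⟨y, g, hg⟩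
        refine ⟨g, ?_⟩
        have hy : ActionCategory.objEquiv G X.V (g⁻¹ • x.back) = y := by
          have : g⁻¹ • x.back = y.back := by
            rw [inv_smul_eq_iff]
            exact hg.symm
          rw [this]
          rfl
        exact mk_eq_of_eq hy g _ hg
  have key : ∀ (θ : X.V → V →ₗ[k] W) (x : ActionCategory G X.V),
      letI := Fintype.ofFinite (Σ y : ActionCategory G X.V, y ⟶ x)
      (∑ a : (Σ y : ActionCategory G X.V, y ⟶ x), (repConst ρ X).map (inv a.2) ≫
        (ModuleCat.ofHom (θ a.1.back) : (repConst ρ X).obj a.1 ⟶ (repConst σ X).obj a.1) ≫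
          (repConst σ X).map a.2).hom =
        ∑ g : G, σ g ∘ₗ θ (g⁻¹ • x.back) ∘ₗ ρ g⁻¹ := by
    intro θ x
    let _ := Fintype.ofFinite (Σ y : ActionCategory G X.V, y ⟶ x)
    rw [ModuleCat.hom_sum, ← (e x).sum_comp]
    refine Finset.sum_congr rfl fun g _ => ?_
    have hg : (inv ((e x) g).2).1 = g⁻¹ := actionCategory_inv_val ((e x) g).2
    change σ g ∘ₗ θ (g⁻¹ • x.back) ∘ₗ ρ (inv ((e x) g).2).1 = _
    rw [hg]
  constructor
  · rintro ⟨θ, hθ⟩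
    refine ⟨fun x => (θ (ActionCategory.objEquiv G X.V x)).hom, fun x => ?_⟩
    have h1 := congrArg ModuleCat.Hom.hom (hθ (ActionCategory.objEquiv G X.V x))
    exact h1.trans (key (fun x => (θ (ActionCategory.objEquiv G X.V x)).hom)
      (ActionCategory.objEquiv G X.V x))
  · rintro ⟨θ, hθ⟩
    refine ⟨fun x => ModuleCat.ofHom (θ x.back), fun x => ModuleCat.hom_ext ?_⟩
    exact (hθ x.back).trans (key θ x).symm

/-- The stable isomorphism defined by a pair of stably inverse families. -/
def stabIso {F : X.V → V →ₗ[k] W} {S : X.V → W →ₗ[k] V} (h : StablyInverse ρ σ F S) :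
    (toStab (GRep k X)).obj (repConst ρ X) ≅ (toStab (GRep k X)).obj (repConst σ X) where
  hom := (toStab (GRep k X)).map (famHom F h.left)
  inv := (toStab (GRep k X)).map (famHom S h.right)
  hom_inv_id := by
    rw [← CategoryTheory.Functor.map_comp, ← CategoryTheory.Functor.map_id, toStab_map_eq_iff_isTrace]
    exact h.right_left
  inv_hom_id := by
    rw [← CategoryTheory.Functor.map_comp, ← CategoryTheory.Functor.map_id, toStab_map_eq_iff_isTrace]
    exact h.left_right

theorem exists_eq_stabIso
    (f : (toStab (GRep k X)).obj (repConst ρ X) ≅ (toStab (GRep k X)).obj (repConst σ X)) :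
    ∃ (F : X.V → V →ₗ[k] W) (S : X.V → W →ₗ[k] V) (h : StablyInverse ρ σ F S),
      f = stabIso h := by
  obtain ⟨a, ha⟩ := (toStab (GRep k X)).map_surjective f.hom
  obtain ⟨b, hb⟩ := (toStab (GRep k X)).map_surjective f.inv
  have h1 := f.hom_inv_id
  have h2 := f.inv_hom_id
  rw [← ha, ← hb, ← CategoryTheory.Functor.map_comp, ← CategoryTheory.Functor.map_id, toStab_map_eq_iff_isTrace] at h1 h2
  exact ⟨homFam a, homFam b, ⟨isEquivariant_homFam a, isEquivariant_homFam b, h1, h2⟩,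
    Iso.ext ha.symm⟩

end GRep

section FDRep

/-- The linear map underlying a morphism of finite dimensional representations. -/
abbrev fdLin {V W : FDRep k G} (f : V ⟶ W) : V →ₗ[k] W := f.hom.hom.hom

theorem isEquivariant_fdLin {V W : FDRep k G} (f : V ⟶ W) :
    IsEquivariant V.ρ W.ρ (fun _ : PUnit.{1} => fdLin f) := fun g _ =>
  congrArg (fun t => t.hom.hom) (f.comm g)

/-- The morphism of finite dimensional representations defined by an equivariant linear map. -/
def fdHom {V W : FDRep k G} (F : V →ₗ[k] W)
    (hF : IsEquivariant V.ρ W.ρ (fun _ : PUnit.{1} => F)) : V ⟶ W where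
  hom := FGModuleCat.ofHom F
  comm g := FGModuleCat.hom_ext (hF g PUnit.unit)

variable [Fintype G]

/-- A `kG`-module is a functor on the one-object groupoid of `G`, whose traces are those over a
one-point `G`-set. -/
theorem toStab_fd_map_eq_iff_isTrace {V W : FDRep k G} (f g : V ⟶ W) :
    (toStab (FDRep k G)).map f = (toStab (FDRep k G)).map g ↔
      IsTrace V.ρ W.ρ (fun _ : PUnit.{1} => fdLin f - fdLin g) := by
  have := HasFiniteBiproducts.of_hasFiniteProducts (C := FGModuleCat k)
  let E := Action.functorCategoryEquivalence (FGModuleCat k) G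
  have hz : HasZeroObject (FDRep k G) := inferInstance
  have hb : HasBinaryBiproducts (FDRep k G) := HasBinaryBiproducts.of_hasBinaryProducts
  rw [toStab_map_eq_iff, ← stableRel_equivalence_iff E,
    stableRel_iff_isTraceMap (projective_fgModuleCat k)]
  let e : ∀ x : SingleObj G, G ≃ (Σ y : SingleObj G, y ⟶ x) := fun x =>
    Equiv.ofBijective (fun g => ⟨SingleObj.star G, g⟩) <| by
      constructor
      · intro g h hgh
        exact eq_of_heq (Sigma.mk.inj_iff.mp hgh).2
      · rintro ⟨y, g⟩
        exact ⟨g, rfl⟩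
  have key : ∀ (θ : V →ₗ[k] W) (x : SingleObj G),
      letI := Fintype.ofFinite (Σ y : SingleObj G, y ⟶ x)
      (∑ a : (Σ y : SingleObj G, y ⟶ x), (E.functor.obj V).map (inv a.2) ≫
        (FGModuleCat.ofHom θ : (E.functor.obj V).obj a.1 ⟶ (E.functor.obj W).obj a.1) ≫
          (E.functor.obj W).map a.2).hom.hom =
        ∑ g : G, W.ρ g ∘ₗ θ ∘ₗ V.ρ g⁻¹ := by
    intro θ x
    let _ := Fintype.ofFinite (Σ y : SingleObj G, y ⟶ x)
    have h1 : ∀ {A B : FGModuleCat k} {ι : Type v} (s : Finset ι) (f : ι → (A ⟶ B)),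
        (∑ i ∈ s, f i).hom.hom = ∑ i ∈ s, (f i).hom.hom := fun {A B} _ s f =>
      map_sum (AddMonoidHom.mk' (fun f : A ⟶ B => f.hom.hom) fun _ _ => rfl) f s
    rw [h1, ← (e x).sum_comp]
    refine Finset.sum_congr rfl fun g _ => ?_
    have hg : (inv ((e x) g).2 : G) = g⁻¹ := by
      have h := IsIso.hom_inv_id ((e x) g).2
      exact eq_inv_of_mul_eq_one_left (a := (inv ((e x) g).2 : G)) h
    change W.ρ g ∘ₗ θ ∘ₗ V.ρ (inv ((e x) g).2 : G) = _
    rw [hg]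
  constructor
  · rintro ⟨θ, hθ⟩
    refine ⟨fun _ => (θ (SingleObj.star G)).hom.hom, fun x => ?_⟩
    have h1 := congrArg (fun t => t.hom.hom) (hθ (SingleObj.star G))
    exact h1.trans (key (θ (SingleObj.star G)).hom.hom (SingleObj.star G))
  · rintro ⟨θ, hθ⟩
    refine ⟨fun x => FGModuleCat.ofHom (θ PUnit.unit), fun x => FGModuleCat.hom_ext ?_⟩
    exact (hθ PUnit.unit).trans (key (θ PUnit.unit) x).symm

/-- The stable isomorphism defined by a pair of stably inverse equivariant maps. -/
def fdStabIso {V W : FDRep k G} {F : PUnit.{1} → V →ₗ[k] W} {S : PUnit.{1} → W →ₗ[k] V}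
    (h : StablyInverse V.ρ W.ρ F S) :
    (toStab (FDRep k G)).obj V ≅ (toStab (FDRep k G)).obj W where
  hom := (toStab (FDRep k G)).map (fdHom (F PUnit.unit) h.left)
  inv := (toStab (FDRep k G)).map (fdHom (S PUnit.unit) h.right)
  hom_inv_id := by
    rw [← CategoryTheory.Functor.map_comp, ← CategoryTheory.Functor.map_id, toStab_fd_map_eq_iff_isTrace]
    exact h.right_left
  inv_hom_id := by
    rw [← CategoryTheory.Functor.map_comp, ← CategoryTheory.Functor.map_id, toStab_fd_map_eq_iff_isTrace]
    exact h.left_right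

theorem exists_stablyInverse_of_fd_iso {V W : FDRep k G}
    (f : (toStab (FDRep k G)).obj V ≅ (toStab (FDRep k G)).obj W) :
    ∃ (F : V →ₗ[k] W) (S : W →ₗ[k] V),
      StablyInverse V.ρ W.ρ (fun _ : PUnit.{1} => F) (fun _ => S) := by
  obtain ⟨a, ha⟩ := (toStab (FDRep k G)).map_surjective f.hom
  obtain ⟨b, hb⟩ := (toStab (FDRep k G)).map_surjective f.inv
  have h1 := f.hom_inv_id
  have h2 := f.inv_hom_id
  rw [← ha, ← hb, ← CategoryTheory.Functor.map_comp, ← CategoryTheory.Functor.map_id, toStab_fd_map_eq_iff_isTrace] at h1 h2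
  exact ⟨fdLin a, fdLin b, isEquivariant_fdLin a, isEquivariant_fdLin b, h1, h2⟩

end FDRep

end Bridge

/-! ### Values of stable automorphisms of the unit -/

section Evaluation

variable {k : Type u} [Field k] {G : Type v} [Group G]

theorem dvd_card_stabilizer_hom (p : ℕ) {X Y : GSet G} (φ : Y ⟶ X) {y : Y.V}
    (hy : p ∣ Nat.card (MulAction.stabilizer G y)) :
    p ∣ Nat.card (MulAction.stabilizer G (φ.hom y)) :=
  hy.trans (Subgroup.card_dvd_of_le (gset_stabilizer_le φ y))

theorem pOrbit_smul (p : ℕ) {X : GSet G} (g : G) (x : X.V)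
    (hx : p ∣ Nat.card (MulAction.stabilizer G x))
    (hx' : p ∣ Nat.card (MulAction.stabilizer G (g • x))) : pOrbit (g • x) hx' = pOrbit x hx :=
  Subtype.ext (Quotient.sound ⟨g, rfl⟩)

theorem dvd_card_stabilizer_smul_iff (p : ℕ) {X : Type*} [MulAction G X] (g : G) (x : X) :
    p ∣ Nat.card (MulAction.stabilizer G (g • x)) ↔ p ∣ Nat.card (MulAction.stabilizer G x) := by
  rw [Nat.card_congr (MulAction.stabilizerEquivStabilizer (G := G) (a := x) (b := g • x)
    (g := g) rfl).toEquiv]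

theorem exists_pOrbit (p : ℕ) {X : GSet G} (o : POrbits p X) :
    ∃ (x : X.V) (hx : p ∣ Nat.card (MulAction.stabilizer G x)), o = pOrbit x hx := by
  obtain ⟨o, x, rfl, hx⟩ := o
  exact ⟨x, hx, rfl⟩

/-- The scalar by which a morphism of unit representations acts at a point. -/
def unitScalar {X : GSet G} (m : unitRep k X ⟶ unitRep k X) (x : X.V) : k :=
  (m.app (ActionCategory.objEquiv G X.V x)).hom (1 : k)

theorem unitScalar_comp {X : GSet G} (m m' : unitRep k X ⟶ unitRep k X) (x : X.V) :
    unitScalar (m ≫ m') x = unitScalar m' x * unitScalar m x := by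
  change (m'.app _).hom ((m.app _).hom (1 : k)) = _
  have h := (m'.app (ActionCategory.objEquiv G X.V x)).hom.map_smul
    ((m.app (ActionCategory.objEquiv G X.V x)).hom (1 : k) : k) (1 : k)
  simp only [smul_eq_mul, mul_one] at h
  rw [h]
  exact mul_comm (G := k) _ _

theorem unitScalar_smul {X : GSet G} (m : unitRep k X ⟶ unitRep k X) (g : G) (x : X.V) :
    unitScalar m (g • x) = unitScalar m x :=
  (isEquivariant_homFam (ρ := Representation.trivial k G k)
    (σ := Representation.trivial k G k) m).apply_one g x

/-- The automorphism of the unit representation that acts by given scalars. -/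
def scalarAut {X : GSet G} (c : X.V → kˣ) (hc : ∀ (g : G) x, c (g • x) = c x) :
    Aut (unitRep k X) where
  hom := famHom (ρ := Representation.trivial k G k) (σ := Representation.trivial k G k)
    (fun x => (c x : k) • LinearMap.id)
    (IsEquivariant.id.smul (fun x => (c x : k)) fun g x => by rw [hc])
  inv := famHom (ρ := Representation.trivial k G k) (σ := Representation.trivial k G k)
    (fun x => ((c x)⁻¹ : kˣ).1 • LinearMap.id)
    (IsEquivariant.id.smul (fun x => ((c x)⁻¹ : kˣ).1) fun g x => by rw [hc])
  hom_inv_id := by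
    ext x : 2
    refine ModuleCat.hom_ext (LinearMap.ext_ring ?_)
    change ((c x.back)⁻¹ : kˣ).1 • (c x.back : k) • (1 : k) = 1
    simp
  inv_hom_id := by
    ext x : 2
    refine ModuleCat.hom_ext (LinearMap.ext_ring ?_)
    change (c x.back : k) • ((c x.back)⁻¹ : kˣ).1 • (1 : k) = 1
    simp

theorem unitScalar_scalarAut {X : GSet G} (c : X.V → kˣ) (hc : ∀ (g : G) x, c (g • x) = c x)
    (x : X.V) : unitScalar (scalarAut c hc).hom x = c x :=
  mul_one (c x : k)

variable [Fintype G] (p : ℕ) [CharP k p]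

theorem toStab_unit_map_eq_iff {X : GSet G} (m m' : unitRep k X ⟶ unitRep k X) :
    (toStab (GRep k X)).map m = (toStab (GRep k X)).map m' ↔
      ∀ x : X.V, p ∣ Nat.card (MulAction.stabilizer G x) → unitScalar m x = unitScalar m' x :=
  (toStab_map_eq_iff_isTrace (ρ := Representation.trivial k G k)
    (σ := Representation.trivial k G k) m m').trans
    (isTrace_sub_iff p
      (isEquivariant_homFam (ρ := Representation.trivial k G k)
        (σ := Representation.trivial k G k) m)
      (isEquivariant_homFam (ρ := Representation.trivial k G k)
        (σ := Representation.trivial k G k) m'))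

/-- The value of a stable automorphism of the unit at a point whose stabilizer has order divisible
by `p`. -/
noncomputable def autEv {X : GSet G} (x : X.V) (hx : p ∣ Nat.card (MulAction.stabilizer G x)) :
    Aut (stUnit k X) →* kˣ :=
  MonoidHom.toHomUnits
    -- The lift to an honest endomorphism is arbitrary: at points whose stabilizer has order
    -- divisible by `p`, stably equal lifts have the same scalar.
    { toFun := fun a => unitScalar ((toStab (GRep k X)).map_surjective a.hom).choose x
      map_one' := by
        refine ((toStab_unit_map_eq_iff p _ (𝟙 _)).mp ?_ x hx).trans rfl
        exact ((toStab (GRep k X)).map_surjective (1 : Aut (stUnit k X)).hom).choose_spec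
      map_mul' := fun a b => by
        rw [← unitScalar_comp]
        refine (toStab_unit_map_eq_iff p _ _).mp ?_ x hx
        rw [Functor.map_comp, ((toStab (GRep k X)).map_surjective (a * b).hom).choose_spec,
          ((toStab (GRep k X)).map_surjective a.hom).choose_spec,
          ((toStab (GRep k X)).map_surjective b.hom).choose_spec]
        rfl }

/-- The value of a section of `Gm` at a point whose stabilizer has order divisible by `p`. -/
noncomputable def gmEv {X : GSet G} (x : X.V) (hx : p ∣ Nat.card (MulAction.stabilizer G x)) :
    (Gm G k).obj (op X) →+ Additive kˣ :=
  show Additive (Aut (stUnit k X)) →+ Additive kˣ from MonoidHom.toAdditive (autEv (k := k) p x hx)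

/-- The value of a stable automorphism as an element of the field. -/
noncomputable abbrev gmVal {X : GSet G} (x : X.V)
    (hx : p ∣ Nat.card (MulAction.stabilizer G x)) (z : (Gm G k).obj (op X)) : k :=
  ((gmEv (k := k) p x hx z).toMul : kˣ)

theorem gmVal_eq {X : GSet G} (x : X.V) (hx : p ∣ Nat.card (MulAction.stabilizer G x))
    (a : Aut (stUnit k X)) (m : unitRep k X ⟶ unitRep k X)
    (hm : (toStab (GRep k X)).map m = a.hom) :
    gmVal p x hx (Additive.ofMul a) = unitScalar m x :=
  (toStab_unit_map_eq_iff p _ _).mp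
    (((toStab (GRep k X)).map_surjective a.hom).choose_spec.trans hm.symm) x hx

theorem gm_ext {X : GSet G} {z z' : (Gm G k).obj (op X)}
    (h : ∀ (x : X.V) (hx : p ∣ Nat.card (MulAction.stabilizer G x)),
      gmVal p x hx z = gmVal p x hx z') : z = z' := by
  obtain ⟨m, hm⟩ := (toStab (GRep k X)).map_surjective (Additive.toMul z : Aut (stUnit k X)).hom
  obtain ⟨m', hm'⟩ := (toStab (GRep k X)).map_surjective (Additive.toMul z' : Aut (stUnit k X)).hom
  suffices h1 : (Additive.toMul z : Aut (stUnit k X)) = (Additive.toMul z' : Aut (stUnit k X)) from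
    congrArg Additive.ofMul h1
  refine Iso.ext ?_
  rw [← hm, ← hm', toStab_unit_map_eq_iff p]
  intro x hx
  rw [← gmVal_eq p x hx _ m hm, ← gmVal_eq p x hx _ m' hm']
  exact h x hx

theorem gmVal_smul {X : GSet G} (x y : X.V) (hx : p ∣ Nat.card (MulAction.stabilizer G x))
    (hy : p ∣ Nat.card (MulAction.stabilizer G y)) (g : G) (hg : g • x = y)
    (z : (Gm G k).obj (op X)) : gmVal p y hy z = gmVal p x hx z := by
  subst hg
  obtain ⟨m, hm⟩ := (toStab (GRep k X)).map_surjective (Additive.toMul z : Aut (stUnit k X)).hom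
  exact (gmVal_eq p _ hy _ m hm).trans ((unitScalar_smul m g x).trans
    (gmVal_eq p x hx _ m hm).symm)

theorem gmEv_map {X Y : GSet G} (φ : Y ⟶ X) (y : Y.V)
    (hy : p ∣ Nat.card (MulAction.stabilizer G y))
    (hx : p ∣ Nat.card (MulAction.stabilizer G (φ.hom y)))
    (z : (Gm G k).obj (op X)) :
    gmEv p y hy (((Gm G k).map φ.op).hom z) = gmEv p (φ.hom y) hx z := by
  obtain ⟨m, hm⟩ := (toStab (GRep k X)).map_surjective (Additive.toMul z : Aut (stUnit k X)).hom
  refine congrArg Additive.ofMul (Units.ext ?_)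
  refine (gmVal_eq p y hy _ ((pull k φ).map m) ?_).trans (gmVal_eq p (φ.hom y) hx _ m hm).symm
  change (stPull k φ).map ((toStab (GRep k X)).map m) = _
  rw [hm]
  rfl

theorem gmVal_zero {X : GSet G} (x : X.V) (hx : p ∣ Nat.card (MulAction.stabilizer G x)) :
    gmVal (k := k) p x hx 0 = 1 := by
  rw [gmVal, map_zero]
  rfl

theorem gmVal_add {X : GSet G} (x : X.V) (hx : p ∣ Nat.card (MulAction.stabilizer G x))
    (z z' : (Gm G k).obj (op X)) :
    gmVal p x hx (z + z') = gmVal p x hx z * gmVal p x hx z' := by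
  rw [gmVal, map_add]
  rfl

theorem gmVal_sub {X : GSet G} (x : X.V) (hx : p ∣ Nat.card (MulAction.stabilizer G x))
    (z z' : (Gm G k).obj (op X)) :
    gmVal p x hx (z - z') = gmVal p x hx z / gmVal p x hx z' := by
  rw [gmVal, map_sub, toMul_sub, Units.val_div_eq_div_val]

theorem gmVal_map {X Y : GSet G} (φ : Y ⟶ X) (y : Y.V)
    (hy : p ∣ Nat.card (MulAction.stabilizer G y)) (z : (Gm G k).obj (op X)) :
    gmVal p y hy (((Gm G k).map φ.op).hom z) =
      gmVal p (φ.hom y) (dvd_card_stabilizer_hom p φ hy) z := by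
  rw [gmVal, gmEv_map p φ y hy (dvd_card_stabilizer_hom p φ hy)]

theorem exists_gm_of_val {X : GSet G} (c : X.V → kˣ) (hc : ∀ (g : G) x, c (g • x) = c x) :
    ∃ z : (Gm G k).obj (op X), ∀ x hx, gmVal p x hx z = c x :=
  ⟨Additive.ofMul ((toStab (GRep k X)).mapIso (scalarAut c hc)), fun x hx =>
    (gmVal_eq p x hx _ (scalarAut c hc).hom rfl).trans (unitScalar_scalarAut c hc x)⟩

end Evaluation

/-! ### The isomorphism with the constant sipp sheaf -/

section ConstantSheaf

variable {k : Type u} [Field k] {G : Type v} [Group G] [Fintype G] (p : ℕ) [CharP k p]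

/-- The function on orbits defined by a stable automorphism of the unit. -/
noncomputable def gmToFun (X : GSet G) :
    (Gm G k).obj (op X) →+ (POrbits p X → Additive kˣ) where
  toFun z o := gmEv p o.2.choose o.2.choose_spec.2 z
  map_zero' := by
    ext o : 1
    exact map_zero _
  map_add' z z' := by
    ext o : 1
    exact map_add _ _ _

theorem gmToFun_pOrbit {X : GSet G} (z : (Gm G k).obj (op X)) (x : X.V)
    (hx : p ∣ Nat.card (MulAction.stabilizer G x)) :
    gmToFun p X z (pOrbit x hx) = gmEv p x hx z := by
  have h : (MulAction.orbitRel G X.V).r (pOrbit x hx).2.choose x :=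
    Quotient.exact (pOrbit x hx).2.choose_spec.1
  obtain ⟨g, hg⟩ := h
  exact congrArg Additive.ofMul (Units.ext
    (gmVal_smul p x (pOrbit x hx).2.choose hx (pOrbit x hx).2.choose_spec.2 g hg z))

theorem gmToFun_bijective (X : GSet G) : Function.Bijective (gmToFun (k := k) p X) := by
  classical
  constructor
  · intro z z' h
    refine gm_ext p fun x hx => ?_
    rw [gmVal, gmVal, ← gmToFun_pOrbit, ← gmToFun_pOrbit, h]
  · intro c
    obtain ⟨z, hz⟩ := exists_gm_of_val (k := k) p (X := X)
      -- The values on the remaining orbits are stably invisible; `1` keeps the scalars invertible.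
      (fun x => if hx : p ∣ Nat.card (MulAction.stabilizer G x) then (c (pOrbit x hx)).toMul else 1)
      (fun g x => by
        by_cases hx : p ∣ Nat.card (MulAction.stabilizer G x)
        · rw [dif_pos hx, dif_pos ((dvd_card_stabilizer_smul_iff p g x).mpr hx),
            pOrbit_smul p g x hx]
        · rw [dif_neg hx, dif_neg fun h => hx ((dvd_card_stabilizer_smul_iff p g x).mp h)])
    refine ⟨z, funext fun o => ?_⟩
    obtain ⟨x, hx, rfl⟩ := exists_pOrbit p o
    rw [gmToFun_pOrbit]
    have h := hz x hx
    rw [dif_pos hx] at h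
    exact congrArg Additive.ofMul (Units.ext h)

/-- Stable automorphisms of the unit form the constant sipp sheaf. -/
noncomputable def gmIsoConstSheaf : Gm G k ≅ constSheaf G p (Additive kˣ) :=
  NatIso.ofComponents
    (fun X => (AddEquiv.ofBijective (gmToFun p X.unop) (gmToFun_bijective p _)).toAddCommGrpIso)
    fun {X Y} φ => by
      ext z
      refine funext fun o => ?_
      obtain ⟨x, hx, rfl⟩ := exists_pOrbit p o
      exact (gmToFun_pOrbit p _ x hx).trans ((gmEv_map p φ.unop x hx
        (dvd_card_stabilizer_hom p φ.unop hx) z).trans (gmToFun_pOrbit p z _ _).symm)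

theorem exists_constSheaf_iso : ∃ θ : constSheaf G p (Additive kˣ) ≅ Gm G k,
    ∀ (X : GSet G) (c : POrbits p X → Additive kˣ) (a : Aut (unitRep k X)),
      (∀ (x : X.V) (hx : p ∣ Nat.card (MulAction.stabilizer G x)) (t : k),
        (a.hom.app ((ActionCategory.objEquiv G X.V) x)).hom t =
          ((c (pOrbit x hx)).toMul : k) * t) →
      (θ.hom.app (op X)).hom c = Additive.ofMul ((toStab _).mapIso a) := by
  refine ⟨(gmIsoConstSheaf p).symm, fun X c a h => ?_⟩
  refine (AddEquiv.symm_apply_eq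
    (AddEquiv.ofBijective (gmToFun (k := k) p X) (gmToFun_bijective p _))).mpr (funext fun o => ?_)
  obtain ⟨x, hx, rfl⟩ := exists_pOrbit p o
  refine Eq.trans (congrArg Additive.ofMul (Units.ext ?_)) (gmToFun_pOrbit p _ x hx).symm
  refine Eq.trans ?_ (gmVal_eq p x hx _ a.hom rfl).symm
  refine Eq.trans ?_ (h x hx 1).symm
  exact (mul_one _).symm

end ConstantSheaf

/-! ### Low-degree Čech cochains -/

section CechLowDegree

variable {G : Type v} [Group G] (P : (GSet G)ᵒᵖ ⥤ AddCommGrpCat.{w}) {U X : GSet G} (α : U ⟶ X)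

theorem cechD_zero_apply (z : P.obj (op (fibPow α 1))) :
    cechD P α 0 z = (P.map (fibFace α 0).op).hom z - (P.map (fibFace α 1).op).hom z := by
  rw [cechD, Fin.sum_univ_two]
  simp [sub_eq_add_neg]

theorem cechD_one_apply (z : P.obj (op (fibPow α 2))) :
    cechD P α 1 z = (P.map (fibFace α 0).op).hom z - (P.map (fibFace α 1).op).hom z +
      (P.map (fibFace α 2).op).hom z := by
  rw [cechD, Fin.sum_univ_three]
  simp [sub_eq_add_neg]

theorem smul_fibPow_eq_iff {n : ℕ} (g : G) (w : FibPow α n) :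
    g • w = w ↔ ∀ i, g • w.1 i = w.1 i := by
  rw [Subtype.ext_iff, funext_iff]
  rfl

theorem stabilizer_fibPow_two (w : FibPow α 2) :
    MulAction.stabilizer G w = MulAction.stabilizer G (w.1 0, w.1 1) := by
  ext g
  rw [MulAction.mem_stabilizer_iff, MulAction.mem_stabilizer_iff, smul_fibPow_eq_iff,
    Fin.forall_fin_two, Prod.ext_iff]
  rfl

theorem stabilizer_fibPow_three (w : FibPow α 3) :
    MulAction.stabilizer G w = MulAction.stabilizer G (w.1 0, w.1 1, w.1 2) := by
  ext g
  rw [MulAction.mem_stabilizer_iff, MulAction.mem_stabilizer_iff, smul_fibPow_eq_iff,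
    Prod.ext_iff, Prod.ext_iff]
  exact ⟨fun h => ⟨h 0, h 1, h 2⟩, fun ⟨h0, h1, h2⟩ i => by
    fin_cases i
    exacts [h0, h1, h2]⟩

theorem dvd_card_face (p : ℕ) {U X : GSet G} (α : U ⟶ X) {n : ℕ} (i : Fin (n + 1)) {w : FibPow α (n + 1)}
    (hw : p ∣ Nat.card (MulAction.stabilizer G w)) :
    p ∣ Nat.card (MulAction.stabilizer G
      (⟨fun j => w.1 (i.succAbove j), fun _ _ => w.2 _ _⟩ : FibPow α n)) :=
  dvd_card_stabilizer_hom p (fibFace α i) hw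

theorem dvd_card_proj (p : ℕ) {U X : GSet G} (α : U ⟶ X) {n : ℕ} (i : Fin n) {w : FibPow α n}
    (hw : p ∣ Nat.card (MulAction.stabilizer G w)) :
    p ∣ Nat.card (MulAction.stabilizer G (w.1 i)) :=
  dvd_card_stabilizer_hom p (fibProj α i) hw

end CechLowDegree

/-! ### The gluing cocycle: cocycle condition, independence, tensor products and descent -/

section Gluing

variable {k : Type u} [Field k] {G : Type v} [Group G] [Fintype G] (p : ℕ) [CharP k p]
variable {U X : GSet G} (α : U ⟶ X) {V V' : FDRep k G}

variable {α} in
/-- The value of a Čech cochain at a point of the fibre product. -/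
noncomputable def fibVal {n : ℕ} (w : FibPow α n) (hw : p ∣ Nat.card (MulAction.stabilizer G w))
    (z : (Gm G k).obj (op (fibPow α n))) : k :=
  gmVal p (X := fibPow α n) w hw z

theorem fibVal_ne_zero {n : ℕ} (w : FibPow α n) (hw : p ∣ Nat.card (MulAction.stabilizer G w))
    (z : (Gm G k).obj (op (fibPow α n))) : fibVal p w hw z ≠ 0 :=
  Units.ne_zero _

theorem fibVal_zero {n : ℕ} (w : FibPow α n) (hw : p ∣ Nat.card (MulAction.stabilizer G w)) :
    fibVal (k := k) p w hw 0 = 1 :=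
  gmVal_zero p (X := fibPow α n) w hw

theorem fibVal_add {n : ℕ} (w : FibPow α n) (hw : p ∣ Nat.card (MulAction.stabilizer G w))
    (z z' : (Gm G k).obj (op (fibPow α n))) :
    fibVal p w hw (z + z') = fibVal p w hw z * fibVal p w hw z' :=
  gmVal_add p (X := fibPow α n) w hw z z'

theorem fibVal_sub {n : ℕ} (w : FibPow α n) (hw : p ∣ Nat.card (MulAction.stabilizer G w))
    (z z' : (Gm G k).obj (op (fibPow α n))) :
    fibVal p w hw (z - z') = fibVal p w hw z / fibVal p w hw z' :=
  gmVal_sub p (X := fibPow α n) w hw z z'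

theorem fibVal_ext {n : ℕ} {z z' : (Gm G k).obj (op (fibPow α n))}
    (h : ∀ (w : FibPow α n) (hw : p ∣ Nat.card (MulAction.stabilizer G w)),
      fibVal p w hw z = fibVal p w hw z') : z = z' :=
  gm_ext p (X := fibPow α n) h

theorem fibVal_face {n : ℕ} (i : Fin (n + 1)) (w : FibPow α (n + 1))
    (hw : p ∣ Nat.card (MulAction.stabilizer G w)) (z : (Gm G k).obj (op (fibPow α n))) :
    fibVal p w hw (((Gm G k).map (fibFace α i).op).hom z) =
      fibVal p _ (dvd_card_face p α i hw) z :=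
  gmVal_map p (fibFace α i) w hw z

theorem fibVal_gluing {F : U.V → V →ₗ[k] k} {S : U.V → k →ₗ[k] V}
    (h : StablyInverse V.ρ (Representation.trivial k G k) F S) (w : FibPow α 2)
    (hw : p ∣ Nat.card (MulAction.stabilizer G w)) :
    fibVal p w hw (gluing α (V := V) (stabIso h)) = F (w.1 0) (S (w.1 1) 1) :=
  gmVal_eq p (X := fibPow α 2) w hw _
    ((pull k (fibProj α 1)).map (famHom S h.right) ≫
      (pull k (fibProj α 0)).map (famHom F h.left)) (Functor.map_comp _ _ _)

/-- Faces `2`, `0`, `1` of `(x, y, t)` are `(x, y)`, `(y, t)`, `(x, t)`: this is `z(x, y) z(y, t) =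
z(x, t)`, the form used by `exists_stablyInverse_of_cocycle`. -/
theorem cechD_gm_one_eq_zero_iff (z : (Gm G k).obj (op (fibPow α 2))) :
    cechD (Gm G k) α 1 z = 0 ↔ ∀ (w : FibPow α 3)
      (hw : p ∣ Nat.card (MulAction.stabilizer G w)),
      fibVal p _ (dvd_card_face p α 2 hw) z * fibVal p _ (dvd_card_face p α 0 hw) z =
        fibVal p _ (dvd_card_face p α 1 hw) z := by
  have key : ∀ (w : FibPow α 3) (hw : p ∣ Nat.card (MulAction.stabilizer G w)),
      fibVal p w hw (cechD (Gm G k) α 1 z) = 1 ↔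
      fibVal p _ (dvd_card_face p α 2 hw) z * fibVal p _ (dvd_card_face p α 0 hw) z =
        fibVal p _ (dvd_card_face p α 1 hw) z := by
    intro w hw
    rw [cechD_one_apply, fibVal_add, fibVal_sub, fibVal_face, fibVal_face, fibVal_face,
      div_mul_eq_mul_div, div_eq_one_iff_eq (fibVal_ne_zero _ _ _ _ _), mul_comm]
  constructor
  · intro h w hw
    rw [← key w hw, h, fibVal_zero]
  · intro h
    exact fibVal_ext p α fun w hw => ((key w hw).mpr (h w hw)).trans (fibVal_zero p α w hw).symm

theorem fibVal_cechD_zero (z : (Gm G k).obj (op (fibPow α 1))) (w : FibPow α 2)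
    (hw : p ∣ Nat.card (MulAction.stabilizer G w)) :
    fibVal p w hw (cechD (Gm G k) α 0 z) =
      fibVal p _ (dvd_card_face p α 0 hw) z / fibVal p _ (dvd_card_face p α 1 hw) z := by
  rw [cechD_zero_apply, fibVal_sub, fibVal_face, fibVal_face]

theorem cechD_gluing (f : stConst k V U ≅ stUnit k U) :
    cechD (Gm G k) α 1 (gluing α f) = 0 := by
  obtain ⟨p, _⟩ := CharP.exists k
  -- `constRep k V U` and `unitRep k U` unfold to `repConst` of `V.ρ` and of the trivial
  -- representation, so `f` is given by a pair of families.
  obtain ⟨F, S, h, rfl⟩ := exists_eq_stabIso (ρ := V.ρ) (σ := Representation.trivial k G k) f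
  refine (cechD_gm_one_eq_zero_iff p α _).mpr fun w hw => ?_
  rw [fibVal_gluing p α h, fibVal_gluing p α h, fibVal_gluing p α h]
  have e : ∀ i : Fin 3, ∀ (g : G) (w : (fibPow α 3).V), (fibProj α i).hom (g • w) =
    g • (fibProj α i).hom w := fun i g w => gset_hom_smul (fibProj α i) g w
  exact (h.pull _ (e 1)).comp_apply_one p (h.left.pull _ (e 0)) (h.right.pull _ (e 2)) w hw

/-- The comparison `a x = F' x ∘ E ∘ S x` is an automorphism of the unit over `U`. Both `a x * (F x
S y)` and `(F' x S' y) * a y` equal `F' x E S y`, so the two cocycles differ by the coboundary `a y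
/ a x`. -/
theorem gluing_sub_gluing_mem
    (e : (toStab (FDRep k G)).obj V ≅ (toStab (FDRep k G)).obj V')
    (f : stConst k V U ≅ stUnit k U) (f' : stConst k V' U ≅ stUnit k U) :
    gluing α f - gluing α f' ∈ (cechD (Gm G k) α 0).range := by
  obtain ⟨p, _⟩ := CharP.exists k
  obtain ⟨F, S, h, rfl⟩ := exists_eq_stabIso (ρ := V.ρ) (σ := Representation.trivial k G k) f
  obtain ⟨F', S', h', rfl⟩ := exists_eq_stabIso (ρ := V'.ρ) (σ := Representation.trivial k G k) f'
  obtain ⟨E, T, hE⟩ := exists_stablyInverse_of_fd_iso e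
  have hEU := hE.pull (fun _ : U.V => PUnit.unit) fun _ _ => rfl
  have ha : StablyInverse (Representation.trivial k G k) (Representation.trivial k G k) _ _ :=
    (StablyInverse.mk h.right h.left h.left_right h.right_left).comp (hEU.comp h')
  let a : Aut (stUnit k U) := stabIso ha
  have hav : ∀ x hx, gmVal (X := U) p x hx (Additive.ofMul a) = F' x (E (S x 1)) := fun x hx =>
    gmVal_eq p x hx a (famHom _ ha.left) rfl
  refine ⟨((Gm G k).map (fibProj α 0).op).hom (Additive.ofMul a), ?_⟩
  refine fibVal_ext p α fun w hw => ?_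
  have h1 : ∀ (v : FibPow α 1) (hv : p ∣ Nat.card (MulAction.stabilizer G v)),
      fibVal p v hv (((Gm G k).map (fibProj α 0).op).hom (Additive.ofMul a)) =
        F' (v.1 0) (E (S (v.1 0) 1)) := fun v hv =>
    (gmVal_map p (fibProj α 0) v hv _).trans (hav _ _)
  rw [fibVal_cechD_zero, fibVal_sub, fibVal_gluing p α h, fibVal_gluing p α h', h1, h1]
  have e : ∀ i : Fin 2, ∀ (g : G) (w : (fibPow α 2).V), (fibProj α i).hom (g • w) =
    g • (fibProj α i).hom w := fun i g w => gset_hom_smul (fibProj α i) g w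
  have c1 := (h.pull _ (e 0)).comp_apply_one p ((h'.left.comp hEU.left).pull _ (e 0))
    (h.right.pull _ (e 1)) w hw
  have c2 := (h'.pull _ (e 1)).comp_apply_one p (h'.left.pull _ (e 0))
    ((hEU.left.comp h.right).pull _ (e 1)) w hw
  have n1 : F' ((w : FibPow α 2).1 0) (E (S ((w : FibPow α 2).1 0) 1)) ≠ 0 := by
    rw [← hav _ (dvd_card_proj p α 0 hw)]
    exact Units.ne_zero _
  have n2 : F' ((w : FibPow α 2).1 0) (S' ((w : FibPow α 2).1 1) 1) ≠ 0 := by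
    rw [← fibVal_gluing p α h' w hw]
    exact fibVal_ne_zero _ _ _ _ _
  refine (div_eq_div_iff n1 n2).mpr ?_
  refine (mul_comm _ _).trans ((c2.trans c1.symm).trans (mul_comm _ _))

end Gluing

section Diagonal

variable {G : Type v} [Group G] {U X : GSet G} (α : U ⟶ X)

/-- The diagonal map from `U` to its one-fold fibre power. -/
def fibDiag : U ⟶ fibPow α 1 :=
  gsetHom (fun u => (⟨fun _ => u, fun _ _ => rfl⟩ : FibPow α 1)) fun _ _ => rfl

theorem fibProj_comp_fibDiag : fibProj α (0 : Fin 1) ≫ fibDiag α = 𝟙 _ := by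
  ext w
  exact Subtype.ext (funext fun i => congrArg w.1 (Subsingleton.elim _ _))

end Diagonal

section Gluing

variable {k : Type u} [Field k] {G : Type v} [Group G] [Fintype G]
variable {U X : GSet G} (α : U ⟶ X) {V V' : FDRep k G}

theorem stablyInverse_lid {Y : Type*} [MulAction G Y] :
    StablyInverse ((Representation.trivial k G k).tprod (Representation.trivial k G k))
      (Representation.trivial k G k)
      (fun _ : Y => (TensorProduct.lid k k).toLinearMap)
      (fun _ : Y => (TensorProduct.lid k k).symm.toLinearMap) where
  left g x := by
    ext
    simp
  right g x := by
    ext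
    simp
  right_left := by
    have h : (TensorProduct.lid k k).symm.toLinearMap ∘ₗ (TensorProduct.lid k k).toLinearMap = LinearMap.id :=
      LinearMap.ext fun t => (TensorProduct.lid k k).symm_apply_apply t
    rw [h]
    exact IsTrace.self _
  left_right := by
    have h : (TensorProduct.lid k k).toLinearMap ∘ₗ (TensorProduct.lid k k).symm.toLinearMap = LinearMap.id :=
      LinearMap.ext fun t => (TensorProduct.lid k k).apply_symm_apply t
    rw [h]
    exact IsTrace.self _

/-- The tensor product of the two trivializations lands in `k ⊗ k = k`, where the transition scalars
multiply. This yields both additivity of the classifying map and invertibility of the modules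
constructed from cocycles. -/
theorem exists_gluing_tensor (f : stConst k V U ≅ stUnit k U) (f' : stConst k V' U ≅ stUnit k U) :
    ∃ f'' : stConst k (V ⊗ V') U ≅ stUnit k U,
      gluing α f'' = gluing α f + gluing α f' := by
  obtain ⟨p, _⟩ := CharP.exists k
  obtain ⟨F, S, h, rfl⟩ := exists_eq_stabIso (ρ := V.ρ) (σ := Representation.trivial k G k) f
  obtain ⟨F', S', h', rfl⟩ := exists_eq_stabIso (ρ := V'.ρ) (σ := Representation.trivial k G k) f'
  have h2 : StablyInverse (FDRep.ρ (V ⊗ V')) (Representation.trivial k G k) _ _ :=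
    (h.tensor h').comp stablyInverse_lid
  refine ⟨stabIso h2, fibVal_ext p α fun w hw => ?_⟩
  rw [fibVal_add, fibVal_gluing p α h, fibVal_gluing p α h']
  exact (fibVal_gluing p α h2 w hw).trans rfl

/-- A stable trivialization can be rescaled by an automorphism of the unit. -/
theorem exists_gluing_rescale (f : stConst k V U ≅ stUnit k U) (a : Aut (stUnit k U)) :
    ∃ f' : stConst k V U ≅ stUnit k U,
      gluing α f' = gluing α f - cechD (Gm G k) α 0
        (((Gm G k).map (fibProj α 0).op).hom (Additive.ofMul a)) := by
  obtain ⟨p, _⟩ := CharP.exists k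
  obtain ⟨F, S, h, rfl⟩ := exists_eq_stabIso (ρ := V.ρ) (σ := Representation.trivial k G k) f
  obtain ⟨A, B, ha, haa⟩ := exists_eq_stabIso (ρ := Representation.trivial k G k)
    (σ := Representation.trivial k G k) (X := U) a
  have hav : ∀ x hx, gmVal (X := U) p x hx (Additive.ofMul a) = A x 1 := fun x hx =>
    gmVal_eq p x hx a (famHom _ ha.left) (by rw [haa]; rfl)
  have h1 : ∀ (v : FibPow α 1) (hv : p ∣ Nat.card (MulAction.stabilizer G v)),
      fibVal p v hv (((Gm G k).map (fibProj α 0).op).hom (Additive.ofMul a)) = A (v.1 0) 1 :=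
    fun v hv => (gmVal_map p (fibProj α 0) v hv _).trans (hav _ _)
  -- Composing with `a` multiplies the transition function by `a x / a y`, the inverse of the
  -- coboundary `a y / a x`.
  have h2 := h.comp ha
  refine ⟨stabIso h2, fibVal_ext p α fun w hw => ?_⟩
  rw [fibVal_sub, fibVal_cechD_zero, h1, h1, fibVal_gluing p α h]
  refine (fibVal_gluing p α h2 w hw).trans ?_
  have hA : ∀ (x : U.V) (c : k), A x c = c * A x 1 := fun x c => by
    rw [← smul_eq_mul, ← map_smul, smul_eq_mul, mul_one]
  have hB : ∀ (x : U.V) (c : k), S x (B x c) = B x c • S x 1 := fun x c => by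
    rw [← map_smul, smul_eq_mul, mul_one]
  have n1 : A (w.1 1) 1 ≠ 0 := by
    rw [← hav _ (dvd_card_proj p α 1 hw)]
    exact Units.ne_zero _
  have n2 : A (w.1 1) 1 * B (w.1 1) 1 = 1 := by
    rw [mul_comm, ← hA]
    exact ha.apply_apply_one p (w.1 1) (dvd_card_proj p α 1 hw)
  change A (w.1 0) (F (w.1 0) (S (w.1 1) (B (w.1 1) 1))) = F (w.1 0) (S (w.1 1) 1) /
    (A (w.1 1) 1 / A (w.1 0) 1)
  rw [hA, hB, map_smul, smul_eq_mul, eq_inv_of_mul_eq_one_right n2, div_div_eq_mul_div,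
    div_eq_mul_inv]
  ring

/-- A stable isomorphism with the unit descends if its class in Čech cohomology vanishes. -/
theorem nonempty_iso_of_gluing_mem (p : ℕ) [CharP k p] (hU : (Nat.card U.V : k) ≠ 0)
    (hα : ∀ x y : U.V, α.hom x = α.hom y)
    (f : stConst k V U ≅ stUnit k U) (hf : gluing α f ∈ (cechD (Gm G k) α 0).range) :
    Nonempty ((toStab (FDRep k G)).obj V ≅ (toStab (FDRep k G)).obj (𝟙_ (FDRep k G))) := by
  obtain ⟨z, hz⟩ := hf
  -- Degree-zero cochains live on the one-fold fibre power; the diagonal moves them to `U`, where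
  -- they can rescale `f`.
  let a : Aut (stUnit k U) := Additive.toMul (((Gm G k).map (fibDiag α).op).hom z)
  have ha : ((Gm G k).map (fibProj α 0).op).hom (Additive.ofMul a) = z := by
    change ((Gm G k).map (fibProj α 0).op).hom (((Gm G k).map (fibDiag α).op).hom z) = z
    have h1 := congrArg (fun t => t.hom z) ((Gm G k).map_comp (fibDiag α).op (fibProj α (0 : Fin 1)).op)
    rw [← op_comp, fibProj_comp_fibDiag, op_id, (Gm G k).map_id] at h1
    exact h1.symm
  obtain ⟨f', hf'⟩ := exists_gluing_rescale α f a
  rw [ha, hz, sub_self] at hf'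
  obtain ⟨F, S, h, rfl⟩ := exists_eq_stabIso (ρ := V.ρ) (σ := Representation.trivial k G k) f'
  have h1 : ∀ x : U.V × U.V, p ∣ Nat.card (MulAction.stabilizer G x) → F x.1 (S x.2 1) = 1 := by
    rintro ⟨x, y⟩ hx
    let w : FibPow α 2 := ⟨![x, y], fun _ _ => hα _ _⟩
    have hw : p ∣ Nat.card (MulAction.stabilizer G w) := by
      rw [stabilizer_fibPow_two]
      exact hx
    have h2 := fibVal_gluing p α h w hw
    rw [hf', fibVal_zero] at h2
    exact h2.symm
  let _ : Fintype U.V := Fintype.ofFinite _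
  rw [Nat.card_eq_fintype_card] at hU
  exact ⟨fdStabIso (W := 𝟙_ (FDRep k G))
    (h.descend (Y := PUnit.{1}) hU (h.isTrace_of_transition_eq_one p h1))⟩

/-- Every Čech cocycle is the gluing cocycle of a module. -/
theorem exists_gluing_eq (p : ℕ) [CharP k p] (hU : (Nat.card U.V : k) ≠ 0)
    (hα : ∀ x y : U.V, α.hom x = α.hom y)
    (z : (Gm G k).obj (op (fibPow α 2))) (hz : cechD (Gm G k) α 1 z = 0) :
    ∃ (V : FDRep k G) (f : stConst k V U ≅ stUnit k U), gluing α f = z := by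
  classical
  rw [cechD_gm_one_eq_zero_iff p] at hz
  let _ : Fintype U.V := Fintype.ofFinite _
  rw [Nat.card_eq_fintype_card] at hU
  let w : U.V → U.V → FibPow α 2 := fun x y => ⟨![x, y], fun _ _ => hα _ _⟩
  -- The cocycle has values only at pairs with stabilizer of order divisible by `p`; extension by
  -- zero is harmless, as the other pairs are not tested.
  let c : U.V → U.V → k := fun x y =>
    if h : p ∣ Nat.card (MulAction.stabilizer G (w x y)) then fibVal p (w x y) h z else 0
  have hw : ∀ (v : FibPow α 2) (hv : p ∣ Nat.card (MulAction.stabilizer G v)),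
      fibVal p v hv z = c (v.1 0) (v.1 1) := by
    intro v hv
    have h1 : v = w (v.1 0) (v.1 1) := Subtype.ext (funext fun i => by fin_cases i <;> rfl)
    have h2 : ∀ (v' : FibPow α 2) (h : v = v') (hv' : p ∣ Nat.card (MulAction.stabilizer G v')),
      fibVal p v hv z = fibVal p v' hv' z := by
        rintro _ rfl _
        rfl
    change _ = dite _ _ _
    rw [dif_pos (h1 ▸ hv)]
    exact h2 _ h1 _
  have hmul : ∀ x y t, p ∣ Nat.card (MulAction.stabilizer G (x, y, t)) →
      c x y * c y t = c x t := by
    intro x y t h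
    let v : FibPow α 3 := ⟨![x, y, t], fun _ _ => hα _ _⟩
    have hv : p ∣ Nat.card (MulAction.stabilizer G v) := by
      rw [stabilizer_fibPow_three]
      exact h
    have h1 := hz v hv
    rw [hw, hw, hw] at h1
    exact h1
  have hne : ∀ x y, p ∣ Nat.card (MulAction.stabilizer G (x, y)) → c x y ≠ 0 := by
    intro x y h
    have h1 : p ∣ Nat.card (MulAction.stabilizer G (w x y)) := by
      rw [stabilizer_fibPow_two]
      exact h
    rw [← show fibVal p (w x y) h1 z = c x y from hw _ h1]
    exact fibVal_ne_zero _ _ _ _ _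
  obtain ⟨d, ρ, F, S, h, hFS⟩ := exists_stablyInverse_of_cocycle p hU c
    (fun g x y => by
      have hg : w (g • x) (g • y) = g • w x y :=
        Subtype.ext (funext fun i => by fin_cases i <;> rfl)
      by_cases h : p ∣ Nat.card (MulAction.stabilizer G (w x y))
      · have h' : p ∣ Nat.card (MulAction.stabilizer G (g • w x y)) :=
          (dvd_card_stabilizer_smul_iff p g _).mpr h
        have e1 := hw _ h'
        have e2 := hw _ h
        have e3 : fibVal p _ h' z = fibVal p _ h z :=
          gmVal_smul p (X := fibPow α 2) (w x y) (g • w x y) h h' g rfl z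
        exact (e1.symm.trans e3).trans e2
      · have h' : ¬ p ∣ Nat.card (MulAction.stabilizer G (w (g • x) (g • y))) := fun h' =>
          h ((dvd_card_stabilizer_smul_iff p g _).mp (hg ▸ h'))
        change dite _ _ _ = dite _ _ _
        rw [dif_neg h, dif_neg h'])
    hmul
    (fun x hx => by
      have h1 : MulAction.stabilizer G (x, x, x) = MulAction.stabilizer G x := by
        ext g
        simp [MulAction.mem_stabilizer_iff, Prod.ext_iff]
      have h2 : MulAction.stabilizer G (x, x) = MulAction.stabilizer G x := by
        ext g
        simp [MulAction.mem_stabilizer_iff, Prod.ext_iff]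
      -- Normalization follows from the cocycle identity: `c x x` is a nonzero idempotent scalar.
      have h3 := hmul x x x (h1 ▸ hx)
      exact mul_left_cancel₀ (hne x x (h2 ▸ hx)) (h3.trans (mul_one _).symm))
  refine ⟨FDRep.of ρ, stabIso (X := U) h, fibVal_ext p α fun v hv => ?_⟩
  refine (fibVal_gluing p α (V := FDRep.of ρ) h v hv).trans ?_
  rw [hw v hv]
  exact hFS _ _ (stabilizer_fibPow_two α v ▸ hv)

end Gluing

/-! ### Restriction to `H` and the sipp-cover `G/H → G/G` -/

section Restriction

variable {k : Type u} [Field k] {G : Type v} [Group G] [Fintype G] (H : Subgroup G)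

/-- The action groupoid of `G/H` is equivalent to `H`: evaluation at the base coset and conjugation
by coset representatives pass between the two kinds of trivialization. -/
theorem nonempty_stConst_iso_iff (V : FDRep k G) :
    Nonempty (stConst k V (gset G (G ⧸ H)) ≅ stUnit k (gset G (G ⧸ H))) ↔
      Nonempty ((toStab (FDRep k H)).obj ((resFD k H).obj V) ≅
        (toStab (FDRep k H)).obj (𝟙_ (FDRep k H))) := by
  let _ : Fintype H := Fintype.ofFinite _
  constructor
  · rintro ⟨f⟩
    obtain ⟨F, S, h, rfl⟩ := exists_eq_stabIso (ρ := V.ρ) (σ := Representation.trivial k G k) f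
    exact ⟨fdStabIso (V := (resFD k H).obj V) (W := 𝟙_ (FDRep k H))
      (StablyInverse.restrict (F := F) (S := S) h)⟩
  · rintro ⟨f⟩
    obtain ⟨F, S, h⟩ := exists_stablyInverse_of_fd_iso f
    have h1 : StablyInverse (ρ := V.ρ) (σ := Representation.trivial k G k) _ _ :=
      StablyInverse.inducedFamily (H := H) (ρ := V.ρ) (σ := Representation.trivial k G k) h
    exact ⟨stabIso (X := gset G (G ⧸ H)) h1⟩

theorem toSkeleton_res_eq_one_iff (V : FDRep k G) :
    Skeleton.monoidHom (stabMap (resFD k H)) (toSkeleton ((toStab (FDRep k G)).obj V)) = 1 ↔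
      Nonempty (stConst k V (gset G (G ⧸ H)) ≅ stUnit k (gset G (G ⧸ H))) := by
  rw [nonempty_stConst_iso_iff]
  change (stabMap (resFD k H)).mapSkeleton.obj (toSkeleton ((toStab (FDRep k G)).obj V)) =
    toSkeleton (𝟙_ (StMod k H)) ↔ _
  rw [Functor.mapSkeleton_obj_toSkeleton]
  exact toSkeleton_eq_toSkeleton_iff

end Restriction

section SippCover

variable {G : Type v} [Group G] (H : Subgroup G)

theorem cast_card_quotient_ne_zero {p : ℕ} [Fact p.Prime] (k : Type u) [Field k] [CharP k p]
    (hH : H.index.Coprime p) : (Nat.card (G ⧸ H) : k) ≠ 0 := by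
  rw [Ne, CharP.cast_eq_zero_iff k p, ← Subgroup.index]
  exact (Nat.Prime.coprime_iff_not_dvd Fact.out).mp hH.symm

variable [Finite G]

theorem orbitCover_hom_eq (x y : G ⧸ H) : (orbitCover H).hom x = (orbitCover H).hom y :=
  (QuotientGroup.subsingleton_quotient_top (G := G)).elim _ _

theorem isSippCover_orbitCover {p : ℕ} (hH : H.index.Coprime p) :
    IsSippCover p (orbitCover H) := fun x => by
  refine ⟨((1 : G) : G ⧸ H), (QuotientGroup.subsingleton_quotient_top (G := G)).elim _ _, ?_⟩
  have h1 : MulAction.stabilizer G ((1 : G) : G ⧸ H) = H := MulAction.stabilizer_quotient H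
  have h2 : MulAction.stabilizer G (show G ⧸ (⊤ : Subgroup G) from x) = ⊤ :=
    eq_top_iff.mpr fun g _ => (QuotientGroup.subsingleton_quotient_top (G := G)).elim _ _
  have h3 : (MulAction.stabilizer G ((1 : G) : G ⧸ H)).relIndex
      (MulAction.stabilizer G (show G ⧸ (⊤ : Subgroup G) from x)) = H.index := by
    rw [h1, h2, Subgroup.relIndex_top_right]
  exact h3 ▸ hH

end SippCover

/-! ### The isomorphism of `T(G, H)` with Čech cohomology -/

section Comparison

variable {G : Type v} [Group G] {P : (GSet G)ᵒᵖ ⥤ AddCommGrpCat.{w}} {U X : GSet G} {α : U ⟶ X}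

theorem cechH_mk_eq_iff {z z' : P.obj (op (fibPow α 2))} (hz : cechD P α 1 z = 0)
    (hz' : cechD P α 1 z' = 0) :
    CechH.mk z hz = CechH.mk z' hz' ↔ z - z' ∈ (cechD P α 0).range := by
  refine (QuotientAddGroup.eq (s := (cechB P α 1).addSubgroupOf (cechD P α 1).ker)).trans ?_
  rw [AddSubgroup.mem_addSubgroupOf, ← neg_mem_iff, cechB]
  refine iff_of_eq (congrArg (· ∈ (cechD P α 0).range) ?_)
  change -(-z + z') = z - z'
  abel

theorem cechH_mk_add {z z' : P.obj (op (fibPow α 2))} (hz : cechD P α 1 z = 0)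
    (hz' : cechD P α 1 z' = 0) :
    CechH.mk (z + z') (by rw [map_add, hz, hz', add_zero]) = CechH.mk z hz + CechH.mk z' hz' :=
  rfl

end Comparison

section EndotrivialKer

variable {k : Type u} [Field k] {G : Type v} [Group G]

theorem exists_toSkeleton_eq (t : Skeleton (StMod k G)) :
    ∃ V : FDRep k G, t = toSkeleton ((toStab (FDRep k G)).obj V) :=
  ⟨((fromSkeleton _).obj t).as, (toSkeleton_fromSkeleton_obj t).symm⟩

theorem toSkeleton_tensor (V W : FDRep k G) :
    toSkeleton ((toStab (FDRep k G)).obj (V ⊗ W)) =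
      toSkeleton ((toStab (FDRep k G)).obj V) * toSkeleton ((toStab (FDRep k G)).obj W) :=
  Skeleton.toSkeleton_tensorObj ((toStab (FDRep k G)).obj V) ((toStab (FDRep k G)).obj W)

variable [Finite G] {H : Subgroup G}

theorem mem_endotrivialKer_iff {t : EndotrivialGroup k G} {V : FDRep k G}
    (h : t.val = toSkeleton ((toStab (FDRep k G)).obj V)) :
    t ∈ EndotrivialKer k H ↔
      Nonempty (stConst k V (gset G (G ⧸ H)) ≅ stUnit k (gset G (G ⧸ H))) := by
  have := Fintype.ofFinite G
  rw [← toSkeleton_res_eq_one_iff, ← h]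
  exact Units.ext_iff

/-- The representations in the stable category that become trivial on `G/H` are classified by their
gluing data. -/
theorem exists_endotrivialKer_hom (k : Type u) [Field k] (H : Subgroup G) :
    ∃ Φ : Additive (EndotrivialKer k H) →+ CechH (Gm G k) (orbitCover H) 1,
      ∀ (t : EndotrivialKer k H) (V : FDRep k G),
        (t : EndotrivialGroup k G).val = toSkeleton ((toStab _).obj V) →
        ∀ f : stConst k V (gset G (G ⧸ H)) ≅ stUnit k (gset G (G ⧸ H)),
          ∃ hf : cechD (Gm G k) (orbitCover H) 1 (gluing (orbitCover H) f) = 0,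
            Φ (Additive.ofMul t) = CechH.mk (gluing (orbitCover H) f) hf := by
  have := Fintype.ofFinite G
  choose V hV using fun t : EndotrivialKer k H =>
    exists_toSkeleton_eq (t : EndotrivialGroup k G).val
  have f : ∀ t, stConst k (V t) (gset G (G ⧸ H)) ≅ stUnit k (gset G (G ⧸ H)) := fun t =>
    ((mem_endotrivialKer_iff (hV t)).mp t.2).some
  let φ : EndotrivialKer k H → CechH (Gm G k) (orbitCover H) 1 := fun t =>
    CechH.mk (gluing (orbitCover H) (f t)) (cechD_gluing _ _)
  have hφ : ∀ (t : EndotrivialKer k H) (W : FDRep k G),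
      (t : EndotrivialGroup k G).val = toSkeleton ((toStab _).obj W) →
      ∀ f' : stConst k W (gset G (G ⧸ H)) ≅ stUnit k (gset G (G ⧸ H)),
        φ t = CechH.mk (gluing (orbitCover H) f') (cechD_gluing _ _) := fun t W hW f' => by
    -- Equal classes in the skeleton give a stable isomorphism, so neither the chosen module nor the
    -- chosen trivialization affects the class.
    refine (cechH_mk_eq_iff _ _).mpr (gluing_sub_gluing_mem _ (Nonempty.some ?_) _ _)
    exact toSkeleton_eq_toSkeleton_iff.mp ((hV t).symm.trans hW)
  refine ⟨AddMonoidHom.mk' (fun t => φ t.toMul) fun s t => ?_, fun t W hW f' =>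
    ⟨cechD_gluing _ _, hφ t W hW f'⟩⟩
  obtain ⟨f', hf'⟩ := exists_gluing_tensor (orbitCover H) (f s.toMul) (f t.toMul)
  refine (hφ (s.toMul * t.toMul) (V s.toMul ⊗ V t.toMul) ?_ f').trans ?_
  · rw [toSkeleton_tensor, ← hV, ← hV]
    rfl
  · exact ((cechH_mk_eq_iff _ (by rw [← hf']; exact cechD_gluing _ _)).mpr
      (by rw [hf', sub_self]; exact zero_mem _)).trans
      (cechH_mk_add (cechD_gluing _ _) (cechD_gluing _ _))

theorem toSkeleton_eq_one_of_gluing_mem {p : ℕ} [Fact p.Prime] [CharP k p]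
    (hH : H.index.Coprime p) {V : FDRep k G}
    (f : stConst k V (gset G (G ⧸ H)) ≅ stUnit k (gset G (G ⧸ H)))
    (hf : gluing (orbitCover H) f ∈ (cechD (Gm G k) (orbitCover H) 0).range) :
    toSkeleton ((toStab (FDRep k G)).obj V) = 1 := by
  have := Fintype.ofFinite G
  exact toSkeleton_eq_toSkeleton_iff.mpr (nonempty_iso_of_gluing_mem (orbitCover H) p
    (cast_card_quotient_ne_zero H k hH) (orbitCover_hom_eq H) f hf)

/-- Every Čech cocycle is the gluing datum of an endotrivial module. -/
theorem exists_endotrivialKer_gluing_eq {p : ℕ} [Fact p.Prime] [CharP k p]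
    (hH : H.index.Coprime p) (z : (Gm G k).obj (op (fibPow (orbitCover H) 2)))
    (hz : cechD (Gm G k) (orbitCover H) 1 z = 0) :
    ∃ (t : EndotrivialKer k H) (V : FDRep k G)
      (f : stConst k V (gset G (G ⧸ H)) ≅ stUnit k (gset G (G ⧸ H))),
      (t : EndotrivialGroup k G).val = toSkeleton ((toStab _).obj V) ∧
        gluing (orbitCover H) f = z := by
  have := Fintype.ofFinite G
  have ex := exists_gluing_eq (orbitCover H) p (cast_card_quotient_ne_zero H k hH)
    (orbitCover_hom_eq H)
  obtain ⟨V, f, hf⟩ := ex z hz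
  -- The module of the opposite cocycle is the tensor inverse: both products have trivial gluing
  -- cocycle, hence are stably the unit.
  obtain ⟨V', f', hf'⟩ := ex (-z) (by rw [map_neg, hz, neg_zero])
  obtain ⟨e, he⟩ := exists_gluing_tensor (orbitCover H) f f'
  obtain ⟨e', he'⟩ := exists_gluing_tensor (orbitCover H) f' f
  have h1 := toSkeleton_eq_one_of_gluing_mem hH e
    (by rw [he, hf, hf', add_neg_cancel]; exact zero_mem _)
  have h2 := toSkeleton_eq_one_of_gluing_mem hH e'
    (by rw [he', hf, hf', neg_add_cancel]; exact zero_mem _)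
  rw [toSkeleton_tensor] at h1 h2
  let t : EndotrivialGroup k G := ⟨_, _, h1, h2⟩
  exact ⟨⟨t, (mem_endotrivialKer_iff (t := t) rfl).mpr ⟨f⟩⟩, V, f, rfl, hf⟩

theorem existsUnique_endotrivialKer_addEquiv {p : ℕ} [Fact p.Prime] [CharP k p]
    (hH : H.index.Coprime p) :
    ∃! Φ : Additive (EndotrivialKer k H) ≃+ CechH (Gm G k) (orbitCover H) 1,
      ∀ (t : EndotrivialKer k H) (V : FDRep k G),
        (t : EndotrivialGroup k G).val = toSkeleton ((toStab _).obj V) →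
        Nonempty (stConst k V (gset G (G ⧸ H)) ≅ stUnit k (gset G (G ⧸ H))) ∧
        ∀ f : stConst k V (gset G (G ⧸ H)) ≅ stUnit k (gset G (G ⧸ H)),
          ∃ hf : cechD (Gm G k) (orbitCover H) 1 (gluing (orbitCover H) f) = 0,
            Φ (Additive.ofMul t) = CechH.mk (gluing (orbitCover H) f) hf := by
  obtain ⟨Φ, hΦ⟩ := exists_endotrivialKer_hom k H
  have hinj : Function.Injective Φ := (injective_iff_map_eq_zero Φ).mpr fun t ht => by
    obtain ⟨V, hV⟩ := exists_toSkeleton_eq (t.toMul : EndotrivialGroup k G).val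
    obtain ⟨f⟩ := (mem_endotrivialKer_iff hV).mp t.toMul.2
    obtain ⟨hf, h⟩ := hΦ t.toMul V hV f
    have h0 := (cechH_mk_eq_iff hf (map_zero _)).mp (h.symm.trans ht)
    rw [sub_zero] at h0
    exact congrArg Additive.ofMul (Subtype.ext (Units.ext
      (hV.trans (toSkeleton_eq_one_of_gluing_mem hH f h0))))
  have hsurj : Function.Surjective Φ := fun c => by
    obtain ⟨⟨z, hz⟩, rfl⟩ := QuotientAddGroup.mk_surjective c
    obtain ⟨t, V, f, hV, rfl⟩ := exists_endotrivialKer_gluing_eq hH z hz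
    exact ⟨Additive.ofMul t, (hΦ t V hV f).choose_spec⟩
  refine ⟨AddEquiv.ofBijective Φ ⟨hinj, hsurj⟩, fun t V hV =>
    ⟨(mem_endotrivialKer_iff hV).mp t.2, hΦ t V hV⟩, fun Ψ hΨ => AddEquiv.ext fun t => ?_⟩
  obtain ⟨V, hV⟩ := exists_toSkeleton_eq (t.toMul : EndotrivialGroup k G).val
  -- Some trivialization exists for every element of the kernel, so the prescribed formula leaves no
  -- freedom in the map.
  obtain ⟨⟨f⟩, h⟩ := hΨ t.toMul V hV
  exact (h f).choose_spec.trans (hΦ t.toMul V hV f).choose_spec.symm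

end EndotrivialKer

end SippCech

theorem mainTheorem5 (p : ℕ) [Fact p.Prime] (k : Type u) [Field k] [CharP k p]
    (G : Type v) [Group G] [Finite G]
    (H : Subgroup G) (hH : H.index.Coprime p) :
    IsSippCover p (orbitCover H) ∧
    (∃ θ : constSheaf G p (Additive kˣ) ≅ Gm G k,
      ∀ (X : GSet G) (c : POrbits p X → Additive kˣ) (a : Aut (unitRep k X)),
        (∀ (x : X.V) (hx : p ∣ Nat.card (MulAction.stabilizer G x)) (t : k),
          (a.hom.app ((ActionCategory.objEquiv G X.V) x)).hom t =
            ((c (pOrbit x hx)).toMul : k) * t) →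
        (θ.hom.app (op X)).hom c = Additive.ofMul ((toStab _).mapIso a)) ∧
    ∃! Φ : Additive (EndotrivialKer k H) ≃+ CechH (Gm G k) (orbitCover H) 1,
      ∀ (t : EndotrivialKer k H) (V : FDRep k G),
        (t : EndotrivialGroup k G).val = toSkeleton ((toStab _).obj V) →
        Nonempty (stConst k V (gset G (G ⧸ H)) ≅ stUnit k (gset G (G ⧸ H))) ∧
        ∀ f : stConst k V (gset G (G ⧸ H)) ≅ stUnit k (gset G (G ⧸ H)),
          ∃ hf : cechD (Gm G k) (orbitCover H) 1 (gluing (orbitCover H) f) = 0,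
            Φ (Additive.ofMul t) = CechH.mk (gluing (orbitCover H) f) hf := by
  have := Fintype.ofFinite G
  exact ⟨isSippCover_orbitCover H hH, exists_constSheaf_iso p,
    existsUnique_endotrivialKer_addEquiv hH⟩
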